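/- **Setting.** Let $X\subseteq\mathbb R^n$ be a Borel set and let $f,g$ be $C^1$ vector fields on $X$. A function is called $C^1$ on a set if it is $C^1$ on an open set containing it. Consider the single-input control-affine system $\dot x=f(x)+g(x)u$. Let $N=\mathcal N_\delta$ be a Borel set and put $X_1:=X\setminus N$. Let $h_0\ge 0$ be a Borel function, integrable on $X$, let $d\mu_0=h_0\,dx$ on $X$ be the distribution of initial conditions, and let $X_0\subseteq X$ be the initial set, on which $\mu_0$ is supported in the sense that, up to Lebesgue-null sets, $X_0=\{x\in X: h_0(x)>0\}$. Let $p\ge 0$ be a Borel function (the density describing the unsafe set). Neither $h_0$ nor $p$ has to be normalized. Let $\gamma\ge 0$ and $M\in\mathbb R$. An *admissible feedback* is a function $u=k(x)\in C^1(X)$ such that, for the closed-loop field $F=f+gk$, (i) every solution $s_t(x)$ of $\dot x=F(x)$ with $s_0(x)=x\in X$ exists and stays in $X$ for all $t\ge 0$; (ii) $0\in X$ is a (Lyapunov) stable equilibrium and $N$ is a local domain of attraction of it, that is, a positively invariant neighbourhood of $0$ in $X$ all of whose points in $X$ are attracted to $0$. It *solves the stochastic safety navigation problem with input bound $M$* if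 1. $s_t(x)\to 0$ as $t\to\infty$ for Lebesgue-almost every $x\in X_0$; 2. $0$ is a.e. uniformly stable with respect to $\mu_0$: for every $\varepsilon>0$ there is $T$ with $\int_T^\infty \mu_0(\{x\in X_1: s_t(x)\in B\})\,dt<\varepsilon$ for all Borel $B\subseteq X_1$; 3. the collision functional satisfies $\int_0^\infty\int_{X_1}\mathbf 1_{X_1}(s_t(x))\,p(s_t(x))\,d\mu_0(x)\,dt\le\gamma$ (the factor $\mathbf 1_{X_1}$ may be omitted if $p=0$ on $N$); 4. for $\mu_0$-almost every $x$, $|k(s_t(x))|\le M$ at all times $t\ge 0$ at which $s_t(x)\in X_1$. The *density feasibility problem* is to find $\rho\in L^1(X_1)\cap C^1(X_1,\mathbb R_{\ge0})$ and $\bar\rho\in C^1(X_1,\mathbb R)$ such that $$\nabla\cdot(f\rho+g\bar\rho)=h_0\ \text{ a.e. on }X_1,\qquad \int_{X_1}p\rho\,dx\le\gamma,\qquad |\bar\rho|\le M\rho\ \text{ on }X_1 .$$ **Theorem.** (a) The set of feasible pairs $(\rho,\bar\rho)$ is convex. (b) Let $(\rho,\bar\rho)$ be feasible and let $k$ be an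 admissible feedback with $k=\bar\rho/\rho$ at every point of $X_1$ where $\rho\neq 0$. Then $k$ solves the stochastic safety navigation problem with input bound $M$. Moreover $|k|\le M$ at every point of $X_1$ where $\rho\ne0$, and for $\mu_0$-almost every $x$ the control $u=\bar\rho/\rho$ is well defined along the trajectory outside $N$: if $t\ge 0$ and $s_t(x)\in X_1$, then $\rho(s_t(x))>0$ and $k(s_t(x))=\bar\rho(s_t(x))/\rho(s_t(x))$. (c) Conversely, let $k$ be an admissible feedback that solves the stochastic safety navigation problem with input bound $M$, with $|k|\le M$ on $X_1$. If the occupation measure $B\mapsto\int_0^\infty\mu_0(\{x\in X_1:s_t(x)\in B\})\,dt$ on Borel subsets of $X_1$ has a density $\rho\in C^1(X_1,\mathbb R_{\ge 0})$, then $(\rho,k\rho)$ is feasible. -/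

import Mathlib

open MeasureTheory Set Filter Topology

noncomputable section

namespace SafeNav

/-- The state space `ℝⁿ` with its Euclidean norm. -/
abbrev E (n : ℕ) : Type := EuclideanSpace ℝ (Fin n)

/-- `φ` is continuously differentiable on the (not necessarily open) set `S`:
it is of class `C¹` on an open set containing `S`. -/
def C1On {n : ℕ} {G : Type*} [NormedAddCommGroup G] [NormedSpace ℝ G]
    (φ : E n → G) (S : Set (E n)) : Prop :=
  ∃ U : Set (E n), IsOpen U ∧ S ⊆ U ∧ ContDiffOn ℝ 1 φ U

/-- The divergence `∑ᵢ ∂Vᵢ/∂xᵢ` of a vector field. -/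
def divergence {n : ℕ} (V : E n → E n) (x : E n) : ℝ :=
  ∑ i : Fin n, (fderiv ℝ V x (EuclideanSpace.single i 1)) i

/-- The closed-loop vector field `f + g k` of `ẋ = f(x) + g(x) u` with feedback `u = k(x)`. -/
def closedLoop {n : ℕ} (f g : E n → E n) (k : E n → ℝ) (x : E n) : E n :=
  f x + k x • g x

/-- `s t x` is the solution at time `t ≥ 0` of `ẋ = F(x)` started at `x ∈ X`;
all these solutions exist for all forward times and remain in the state space `X`. -/
def IsSolutionFlow {n : ℕ} (F : E n → E n) (X : Set (E n)) (s : ℝ → E n → E n) : Prop :=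
  ∀ x ∈ X, s 0 x = x ∧
    ∀ t : ℝ, 0 ≤ t → s t x ∈ X ∧
      HasDerivWithinAt (fun τ : ℝ => s τ x) (F (s t x)) (Ici 0) t

/-- The origin is a (Lyapunov) stable equilibrium, and `N` is a local domain of attraction:
a positively invariant neighbourhood of the origin, relative to `X`, all of whose points are
attracted to the origin. -/
structure LocallyStable {n : ℕ} (F : E n → E n) (X N : Set (E n)) (s : ℝ → E n → E n) :
    Prop where
  zero_mem : (0 : E n) ∈ X
  equilibrium : F 0 = 0
  stable : ∀ ε : ℝ, 0 < ε → ∃ η : ℝ, 0 < η ∧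
    ∀ x ∈ X, ‖x‖ < η → ∀ t : ℝ, 0 ≤ t → ‖s t x‖ < ε
  nhds : N ∈ 𝓝[X] (0 : E n)
  invariant : ∀ x ∈ X ∩ N, ∀ t : ℝ, 0 ≤ t → s t x ∈ N
  attracted : ∀ x ∈ X ∩ N, Tendsto (fun t : ℝ => s t x) atTop (𝓝 0)

/-- The measure `dμ₀ = h₀ dx` on `X` of initial conditions. -/
def initMeasure {n : ℕ} (X : Set (E n)) (h₀ : E n → ℝ) : Measure (E n) :=
  (volume.restrict X).withDensity (fun x => ENNReal.ofReal (h₀ x))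

/-- Almost everywhere uniform stability with respect to `μ`, where `X₁` is the complement in the
state space of a local domain of attraction: for every `ε > 0` there is a time `T` such that
`∫_T^∞ μ(B_t) dt < ε` for every Borel set `B ⊆ X₁`, where `B_t = {x ∈ X₁ | s_t(x) ∈ B}`. -/
def AEUniformlyStable {n : ℕ} (X₁ : Set (E n)) (s : ℝ → E n → E n) (μ : Measure (E n)) : Prop :=
  ∀ ε : ENNReal, 0 < ε → ∃ T : ℝ, 0 ≤ T ∧ ∀ B : Set (E n), MeasurableSet B → B ⊆ X₁ →
    ∫⁻ t in Ioi T, μ {x ∈ X₁ | s t x ∈ B} < ε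

/-- The collision functional `∫₀^∞ ∫_{X₁} p(s_t(x)) dμ(x) dt`, in which `p` is counted only on
`X₁` (where a trajectory resides before it reaches the local domain of attraction). -/
def collision {n : ℕ} (X₁ : Set (E n)) (s : ℝ → E n → E n) (μ : Measure (E n))
    (p : E n → ℝ) : ENNReal :=
  ∫⁻ t in Ioi (0 : ℝ), ∫⁻ x in X₁, ENNReal.ofReal (X₁.indicator p (s t x)) ∂μ

/-- The feedback `k`, whose closed-loop solutions are `s`, solves the stochastic safety navigation
problem with initial set `X₀`, initial density `h₀`, unsafe density `p`, collision bound `γ` and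
input bound `M`; `X₁ = X \ N` is the part of the state space outside the local domain of
attraction `N`. -/
structure SolvesNavigation {n : ℕ} (X N X₀ : Set (E n)) (h₀ p : E n → ℝ) (γ M : ℝ)
    (k : E n → ℝ) (s : ℝ → E n → E n) : Prop where
  converges : ∀ᵐ x ∂volume, x ∈ X₀ → Tendsto (fun t : ℝ => s t x) atTop (𝓝 0)
  uniformlyStable : AEUniformlyStable (X \ N) s (initMeasure X h₀)
  safe : collision (X \ N) s (initMeasure X h₀) p ≤ ENNReal.ofReal γ
  inputBound : ∀ᵐ x ∂(initMeasure X h₀), ∀ t : ℝ, 0 ≤ t → s t x ∈ X \ N → |k (s t x)| ≤ M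

/-- The pair `(ρ, ρ')` (`ρ'` is the variable `ρ̄`) is feasible for the density problem on `X₁`:
`ρ ∈ L¹(X₁) ∩ C¹(X₁, ℝ≥0)`, `ρ' ∈ C¹(X₁)`, `∇·(fρ + gρ') = h₀` almost everywhere on `X₁`,
`∫_{X₁} pρ ≤ γ`, and `|ρ'| ≤ Mρ` on `X₁`. -/
structure Feasible {n : ℕ} (f g : E n → E n) (X₁ : Set (E n)) (h₀ p : E n → ℝ) (γ M : ℝ)
    (ρ ρ' : E n → ℝ) : Prop where
  smooth : C1On ρ X₁
  nonneg : ∀ x ∈ X₁, 0 ≤ ρ x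
  integrable : IntegrableOn ρ X₁ volume
  smooth' : C1On ρ' X₁
  div_eq : ∀ᵐ x ∂(volume.restrict X₁), divergence (fun y => ρ y • f y + ρ' y • g y) x = h₀ x
  safe : ∫⁻ x in X₁, ENNReal.ofReal (p x * ρ x) ≤ ENNReal.ofReal γ
  bound : ∀ x ∈ X₁, |ρ' x| ≤ M * ρ x

/-- `ρ` is the density on `X₁` of the occupation measure `B ↦ ∫₀^∞ μ(B_t) dt`,
where `B_t = {x ∈ X₁ | s_t(x) ∈ B}`. -/
def IsOccupationDensity {n : ℕ} (X₁ : Set (E n)) (s : ℝ → E n → E n) (μ : Measure (E n))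
    (ρ : E n → ℝ) : Prop :=
  ∀ B : Set (E n), MeasurableSet B → B ⊆ X₁ →
    ∫⁻ t in Ioi (0 : ℝ), μ {x ∈ X₁ | s t x ∈ B} = ∫⁻ x in B, ENNReal.ofReal (ρ x)

end SafeNav

end

/-!
The proof rests on a duality between the density `ρ` and the occupation measure
`B ↦ ∫₀^∞ μ₀ {x ∈ X₁ | s_t(x) ∈ B} dt` of `X₁ = X \ N`, obtained by the method of characteristics.
Put `F = f + g k`, let `J_t(x) = exp ∫₀ᵗ (∇·F)(s_τ(x)) dτ` and `H = ∇·(ρ F)`.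

* By Liouville's formula (`IsSolutionFlow.exists_hasFDerivWithinAt`) the flow `s_t` is injective and
  differentiable on `X` with Jacobian determinant `J_t`. This gives the change of variables
  `IsTransient.lintegral_image`, although `X` is only a Borel set. Along a trajectory in `X₁`,
  `d/dt (ρ(s_t(x)) J_t(x)) = H(s_t(x)) J_t(x)` (`IsTransient.density_transport`).
* Since `N` is positively invariant, a trajectory that leaves `X₁` never returns. Hence, for `A ⊆ X₁`
  with `s_T(A) ⊆ X₁`, the points of `X₁` that are in `s_T(A)` at time `t ≤ T` form the set
  `s_{T-t}(A)`, and `s_T(A)` collects from `μ₀` during `[0, T]` the mass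
  `∫_A ∫₀ᵀ J_τ(x) h₀(s_τ(x)) dτ dx` (`IsTransient.lintegral_initMeasure_image`).
* Almost every point of `X₁` is reached from `X₁` in some positive time
  (`IsTransient.volume_diff_iUnion_reached`), because the images `s_t(D)` of the set `D` of
  exceptional points are pairwise disjoint.

From a feasible pair to a solution: the input bound gives `ρ' = k ρ` on `X₁`, so `H = h₀` almost
everywhere on `X₁`; derivatives are compared at Lebesgue density points, `X₁` not being open.
Integrating along characteristics, `∫_{s_T(A)} ρ = ∫_A ρ + ∫₀ᵀ μ₀(s_τ(A)) dτ`. Cutting a set `B`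
into layers according to the time for which it can be traced back inside `X₁`, one finds that the
occupation of `B` is at most `∫_B ρ` (`IsTransient.occupation_le`). The occupation of `X₁` is
therefore finite, which gives uniform stability and forces `μ₀`-almost every trajectory to enter `N`;
the collision functional is at most `∫ p ρ`. Finally `h₀ = H = 0` almost everywhere on `{ρ = 0}`, so
`ρ > 0` at `μ₀`-almost every initial state, and `ρ J` does not decrease along trajectories.

From a solution to a feasible pair: uniform stability makes the occupation of `X₁`, that is, `∫ ρ`,
finite, and the collision functional equals `∫ p ρ`. Comparing the occupations of `A` and `s_T(A)`
shows that `∫₀ᵀ (H - h₀)(s_τ(x)) J_τ(x) dτ = 0` for almost every `x` and all `T` before the exit from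
`X₁`. So `H = h₀` along almost every trajectory, hence almost everywhere on the set of points that are
reached, which is almost all of `X₁` (`IsTransient.ae_divergence_eq_of_isOccupationDensity`).
-/

namespace SafeNav

variable {n : ℕ} {F f g : E n → E n} {X X₁ N X₀ : Set (E n)} {s S : ℝ → E n → E n}
  {h₀ p : E n → ℝ} {γ M : ℝ} {k ρ ρ' : E n → ℝ}

/-! ### Continuously differentiable maps on a set -/

lemma C1On.differentiableAt {G : Type*} [NormedAddCommGroup G] [NormedSpace ℝ G] {φ : E n → G}
    (hφ : C1On φ X) {x : E n} (hx : x ∈ X) : DifferentiableAt ℝ φ x := by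
  obtain ⟨U, hU, hXU, h⟩ := hφ
  exact (h.contDiffAt (hU.mem_nhds (hXU hx))).differentiableAt one_ne_zero

lemma C1On.continuousOn {G : Type*} [NormedAddCommGroup G] [NormedSpace ℝ G] {φ : E n → G}
    (hφ : C1On φ X) : ContinuousOn φ X :=
  fun _ hx => (hφ.differentiableAt hx).continuousAt.continuousWithinAt

lemma C1On.mono {G : Type*} [NormedAddCommGroup G] [NormedSpace ℝ G] {φ : E n → G}
    (hφ : C1On φ X) (h : X₁ ⊆ X) : C1On φ X₁ := by
  obtain ⟨U, hU, hXU, hc⟩ := hφ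
  exact ⟨U, hU, h.trans hXU, hc⟩

lemma C1On.smul {G : Type*} [NormedAddCommGroup G] [NormedSpace ℝ G] {ρ : E n → ℝ} {φ : E n → G}
    (hρ : C1On ρ X) (hφ : C1On φ X) : C1On (fun x => ρ x • φ x) X := by
  obtain ⟨U, hU, hXU, h⟩ := hρ
  obtain ⟨V, hV, hXV, h'⟩ := hφ
  exact ⟨U ∩ V, hU.inter hV, subset_inter hXU hXV,
    (h.mono inter_subset_left).smul (h'.mono inter_subset_right)⟩

lemma C1On.add {G : Type*} [NormedAddCommGroup G] [NormedSpace ℝ G] {φ ψ : E n → G}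
    (hφ : C1On φ X) (hψ : C1On ψ X) : C1On (fun x => φ x + ψ x) X := by
  obtain ⟨U, hU, hXU, h⟩ := hφ
  obtain ⟨V, hV, hXV, h'⟩ := hψ
  exact ⟨U ∩ V, hU.inter hV, subset_inter hXU hXV,
    (h.mono inter_subset_left).add (h'.mono inter_subset_right)⟩

lemma C1On.const_smul {G : Type*} [NormedAddCommGroup G] [NormedSpace ℝ G] {φ : E n → G}
    (hφ : C1On φ X) (a : ℝ) : C1On (fun x => a • φ x) X := by
  obtain ⟨U, hU, hXU, h⟩ := hφ
  exact ⟨U, hU, hXU, h.const_smul a⟩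

lemma C1On.closedLoop (hf : C1On f X) (hg : C1On g X) (hk : C1On k X) :
    C1On (SafeNav.closedLoop f g k) X := hf.add (hk.smul hg)

/-! ### The divergence -/

lemma continuousOn_divergence {U : Set (E n)} (hU : IsOpen U) (hF : ContDiffOn ℝ 1 F U) :
    ContinuousOn (divergence F) U := by
  have h := hF.continuousOn_fderiv_of_isOpen hU le_rfl
  unfold divergence
  refine continuousOn_finsetSum _ fun i _ => ?_
  have h1 : ContinuousOn (fun x => fderiv ℝ F x (EuclideanSpace.single i 1)) U :=
    h.clm_apply continuousOn_const
  exact (EuclideanSpace.proj (𝕜 := ℝ) i).continuous.comp_continuousOn h1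

lemma C1On.continuousOn_divergence (hF : C1On F X) : ContinuousOn (divergence F) X := by
  obtain ⟨U, hU, hXU, h⟩ := hF
  exact (SafeNav.continuousOn_divergence hU h).mono hXU

/-- The divergence is Borel for every map `F`, because `fderiv` is. -/
lemma measurable_divergence : Measurable (divergence F) := by
  unfold divergence
  refine Finset.measurable_sum _ fun i _ => ?_
  have h1 : Measurable fun x => fderiv ℝ F x (EuclideanSpace.single i 1) :=
    measurable_fderiv_apply_const ℝ F _
  exact (EuclideanSpace.proj (𝕜 := ℝ) i).continuous.measurable.comp h1

lemma divergence_smul {ρ : E n → ℝ} {x : E n} (hρ : DifferentiableAt ℝ ρ x)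
    (hF : DifferentiableAt ℝ F x) :
    divergence (fun y => ρ y • F y) x = fderiv ℝ ρ x (F x) + ρ x * divergence F x := by
  have hsum : F x = ∑ i, F x i • EuclideanSpace.single i (1 : ℝ) := by
    ext j
    simp [Finset.sum_apply, Pi.single_apply]
  have h1 : fderiv ℝ ρ x (F x) = ∑ i, fderiv ℝ ρ x (EuclideanSpace.single i 1) * F x i := by
    conv_lhs => rw [hsum]
    rw [map_sum]
    exact Finset.sum_congr rfl fun i _ => by rw [map_smul, smul_eq_mul, mul_comm]
  rw [h1, divergence, divergence, Finset.mul_sum, ← Finset.sum_add_distrib]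
  refine Finset.sum_congr rfl fun i _ => ?_
  rw [fderiv_fun_smul hρ hF]
  simp [add_comm]

lemma divergence_linear_comb {V W : E n → E n} {x : E n} (hV : DifferentiableAt ℝ V x)
    (hW : DifferentiableAt ℝ W x) (a b : ℝ) :
    divergence (fun y => a • V y + b • W y) x = a * divergence V x + b * divergence W x := by
  have h : HasFDerivAt (fun y => a • V y + b • W y) (a • fderiv ℝ V x + b • fderiv ℝ W x) x :=
    (hV.hasFDerivAt.const_smul a).add (hW.hasFDerivAt.const_smul b)
  simp only [divergence, Finset.mul_sum, ← Finset.sum_add_distrib, h.fderiv]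
  simp

/-- Differentiable vector fields that agree on a Borel set have the same divergence at almost every
point of it, namely at its Lebesgue density points. -/
lemma ae_divergence_eq {S : Set (E n)} (hS : MeasurableSet S) {V W : E n → E n}
    (hV : ∀ x ∈ S, DifferentiableAt ℝ V x) (hW : ∀ x ∈ S, DifferentiableAt ℝ W x)
    (hVW : EqOn V W S) : ∀ᵐ x ∂(volume.restrict S), divergence V x = divergence W x := by
  have happ : ApproximatesLinearOn (fun x => V x - W x) (0 : E n →L[ℝ] E n) S 0 := by
    intro x hx y hy
    simp [hVW hx, hVW hy]
  filter_upwards [happ.norm_fderiv_sub_le volume hS (fun x => fderiv ℝ V x - fderiv ℝ W x)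
    fun x hx => ((hV x hx).hasFDerivAt.sub (hW x hx).hasFDerivAt).hasFDerivWithinAt] with x hx
  have h0 : fderiv ℝ V x = fderiv ℝ W x := by
    simpa [sub_eq_zero] using hx
  simp only [divergence, h0]

/-! ### Solution flows -/

lemma exists_lipschitzOnWith_of_contDiffOn {U K : Set (E n)} (hU : IsOpen U)
    (hF : ContDiffOn ℝ 1 F U) (hK : IsCompact K) (hKU : K ⊆ U) :
    ∃ L, LipschitzOnWith L F K := by
  refine LocallyLipschitzOn.exists_lipschitzOnWith_of_compact hK fun x hx => ?_
  obtain ⟨L, t, ht, hL⟩ :=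
    (hF.contDiffAt (hU.mem_nhds (hKU hx))).exists_lipschitzOnWith
  exact ⟨L, t, mem_nhdsWithin_of_mem_nhds ht, hL⟩

namespace IsSolutionFlow

lemma zero (hs : IsSolutionFlow F X s) {x : E n} (hx : x ∈ X) : s 0 x = x := (hs x hx).1

lemma mem (hs : IsSolutionFlow F X s) {x : E n} (hx : x ∈ X) {t : ℝ} (ht : 0 ≤ t) :
    s t x ∈ X := ((hs x hx).2 t ht).1

lemma hasDerivWithinAt (hs : IsSolutionFlow F X s) {x : E n} (hx : x ∈ X) {t : ℝ} (ht : 0 ≤ t) :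
    HasDerivWithinAt (fun τ => s τ x) (F (s t x)) (Ici 0) t := ((hs x hx).2 t ht).2

lemma hasDerivWithinAt_Ici (hs : IsSolutionFlow F X s) {x : E n} (hx : x ∈ X) {t : ℝ}
    (ht : 0 ≤ t) : HasDerivWithinAt (fun τ => s τ x) (F (s t x)) (Ici t) t :=
  (hs.hasDerivWithinAt hx ht).mono (Ici_subset_Ici.2 ht)

lemma hasDerivAt (hs : IsSolutionFlow F X s) {x : E n} (hx : x ∈ X) {t : ℝ} (ht : 0 < t) :
    HasDerivAt (fun τ => s τ x) (F (s t x)) t :=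
  (hs.hasDerivWithinAt hx ht.le).hasDerivAt (Ici_mem_nhds ht)

lemma continuousOn (hs : IsSolutionFlow F X s) {x : E n} (hx : x ∈ X) :
    ContinuousOn (fun τ => s τ x) (Ici 0) :=
  fun _ ht => (hs.hasDerivWithinAt hx ht).continuousWithinAt

lemma isCompact_orbit (hs : IsSolutionFlow F X s) {x : E n} (hx : x ∈ X) (T : ℝ) :
    IsCompact ((fun τ => s τ x) '' Icc 0 T) :=
  isCompact_Icc.image_of_continuousOn ((hs.continuousOn hx).mono Icc_subset_Ici_self)

lemma orbit_subset (hs : IsSolutionFlow F X s) {x : E n} (hx : x ∈ X) (T : ℝ) :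
    (fun τ => s τ x) '' Icc 0 T ⊆ X := by
  rintro _ ⟨τ, hτ, rfl⟩; exact hs.mem hx hτ.1

/-- The semigroup property of the flow. -/
lemma add (hs : IsSolutionFlow F X s) (hF : C1On F X) {x : E n} (hx : x ∈ X) {a b : ℝ}
    (ha : 0 ≤ a) (hb : 0 ≤ b) : s (a + b) x = s a (s b x) := by
  obtain ⟨U, hU, hXU, hFU⟩ := hF
  have hxb := hs.mem hx hb
  obtain ⟨L, hL⟩ := exists_lipschitzOnWith_of_contDiffOn hU hFU
    ((hs.isCompact_orbit hx (a + b)).union (hs.isCompact_orbit hxb a))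
    (union_subset ((hs.orbit_subset hx _).trans hXU) ((hs.orbit_subset hxb _).trans hXU))
  have key := ODE_solution_unique_of_mem_Icc_right (v := fun _ => F) (a := 0) (b := a)
    (f := fun τ => s (τ + b) x) (g := fun τ => s τ (s b x)) (fun t _ => hL)
    ((hs.continuousOn hx).comp (by fun_prop)
      (fun t ht => mem_Ici.2 (add_nonneg ht.1 hb)))
    (fun t ht => by
      have h := hs.hasDerivWithinAt_Ici hx (add_nonneg ht.1 hb)
      simpa [Function.comp_def] using h.scomp t ((hasDerivWithinAt_id t (Ici t)).add_const b)
        (fun y (hy : t ≤ y) => by simp only [mem_Ici, id]; linarith))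
    (fun t ht => Or.inl ⟨t + b, ⟨add_nonneg ht.1 hb, by linarith [ht.2]⟩, rfl⟩)
    ((hs.continuousOn hxb).mono Icc_subset_Ici_self)
    (fun t ht => hs.hasDerivWithinAt_Ici hxb ht.1)
    (fun t ht => Or.inr ⟨t, ⟨ht.1, ht.2.le⟩, rfl⟩)
    (by simp [hs.zero hxb])
  exact key ⟨ha, le_rfl⟩

/-- Trajectories do not merge in finite time: solutions are unique backwards in time. -/
lemma injOn (hs : IsSolutionFlow F X s) (hF : C1On F X) {t : ℝ} (ht : 0 ≤ t) :
    InjOn (s t) X := by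
  intro x hx y hy hxy
  obtain ⟨U, hU, hXU, hFU⟩ := hF
  obtain ⟨L, hL⟩ := exists_lipschitzOnWith_of_contDiffOn hU hFU
    ((hs.isCompact_orbit hx t).union (hs.isCompact_orbit hy t))
    (union_subset ((hs.orbit_subset hx _).trans hXU) ((hs.orbit_subset hy _).trans hXU))
  have key := ODE_solution_unique_of_mem_Icc_left (v := fun _ => F) (a := 0) (b := t)
    (f := fun τ => s τ x) (g := fun τ => s τ y) (fun t _ => hL)
    ((hs.continuousOn hx).mono Icc_subset_Ici_self)
    (fun t ht => (hs.hasDerivAt hx ht.1).hasDerivWithinAt)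
    (fun t ht => Or.inl ⟨t, ⟨ht.1.le, ht.2⟩, rfl⟩)
    ((hs.continuousOn hy).mono Icc_subset_Ici_self)
    (fun t ht => (hs.hasDerivAt hy ht.1).hasDerivWithinAt)
    (fun t ht => Or.inr ⟨t, ⟨ht.1.le, ht.2⟩, rfl⟩) hxy
  simpa [hs.zero hx, hs.zero hy] using key ⟨le_rfl, ht⟩

/-- On a bounded time interval, trajectories starting near `x` stay within a Lipschitz distance of
the trajectory of `x`. -/
lemma exists_dist_le (hs : IsSolutionFlow F X s) (hF : C1On F X) {x : E n} (hx : x ∈ X)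
    (T : ℝ) : ∃ δ > 0, ∃ C > 0, ∀ y ∈ X, dist y x < δ → ∀ τ ∈ Icc 0 T,
      dist (s τ y) (s τ x) ≤ C * dist y x := by
  obtain ⟨U, hU, hXU, hFU⟩ := hF
  obtain ⟨r, hr, hrU⟩ := (hs.isCompact_orbit hx T).exists_cthickening_subset_open hU
    ((hs.orbit_subset hx T).trans hXU)
  obtain ⟨L, hL⟩ := exists_lipschitzOnWith_of_contDiffOn hU hFU
    (hs.isCompact_orbit hx T).cthickening hrU
  set C := Real.exp (L * T) with hC
  have hCpos : 0 < C := Real.exp_pos _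
  refine ⟨r / C, by positivity, C, hCpos, fun y hy hyx => ?_⟩
  have hyx' : C * dist y x < r := by rwa [lt_div_iff₀ hCpos, mul_comm] at hyx
  have hcx : ContinuousOn (fun τ => s τ x) (Icc 0 T) :=
    (hs.continuousOn hx).mono Icc_subset_Ici_self
  have hcy : ContinuousOn (fun τ => s τ y) (Icc 0 T) :=
    (hs.continuousOn hy).mono Icc_subset_Ici_self
  -- the Grönwall bound holds at `t` as long as the second trajectory is in the tube before `t`
  have step : ∀ t ∈ Icc 0 T, (∀ τ ∈ Ico 0 t, dist (s τ y) (s τ x) < r) →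
      dist (s t y) (s t x) ≤ C * dist y x := by
    intro t ht hτ
    have h := dist_le_of_trajectories_ODE_of_mem (v := fun _ => F) (K := L) (a := 0) (b := t)
      (f := fun τ => s τ y) (g := fun τ => s τ x) (fun _ _ => hL)
      (hcy.mono (Icc_subset_Icc_right ht.2))
      (fun τ hτ => hs.hasDerivWithinAt_Ici hy hτ.1)
      (fun τ h => Metric.mem_cthickening_of_dist_le _ (s τ x) _ _
        ⟨τ, ⟨h.1, h.2.le.trans ht.2⟩, rfl⟩ (hτ τ h).le)
      (hcx.mono (Icc_subset_Icc_right ht.2))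
      (fun τ hτ => hs.hasDerivWithinAt_Ici hx hτ.1)
      (fun τ h => Metric.self_subset_cthickening _ ⟨τ, ⟨h.1, h.2.le.trans ht.2⟩, rfl⟩)
      (by simp [hs.zero hx, hs.zero hy] : _ ≤ dist y x) t ⟨ht.1, le_rfl⟩
    rw [mul_comm C]
    refine h.trans (mul_le_mul_of_nonneg_left (Real.exp_le_exp.2 ?_) dist_nonneg)
    rw [sub_zero]
    exact mul_le_mul_of_nonneg_left ht.2 L.2
  have hlt : ∀ t ∈ Icc 0 T, dist (s t y) (s t x) < r := by
    by_contra! hne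
    have hcl : IsCompact {t ∈ Icc 0 T | r ≤ dist (s t y) (s t x)} := by
      have := (continuous_dist.comp_continuousOn (hcy.prodMk hcx)).preimage_isClosed_of_isClosed isClosed_Icc
        (isClosed_Ici (a := r))
      exact isCompact_Icc.of_isClosed_subset this inter_subset_left
    obtain ⟨t₀, ⟨ht₀, hrt⟩, hmin⟩ := hcl.exists_isLeast hne
    have := step t₀ ht₀ fun τ hτ => by
      by_contra! h
      exact absurd (hmin ⟨⟨hτ.1, hτ.2.le.trans ht₀.2⟩, h⟩) (not_le.2 hτ.2)
    linarith
  exact fun t ht => step t ht fun τ hτ => hlt τ ⟨hτ.1, hτ.2.le.trans ht.2⟩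

/-- The flow is jointly continuous in time and initial state. -/
lemma continuousOn_uncurry (hs : IsSolutionFlow F X s) (hF : C1On F X) :
    ContinuousOn (fun q : ℝ × E n => s q.1 q.2) (Ici 0 ×ˢ X) := by
  rintro ⟨t, x⟩ ⟨ht, hx⟩
  simp only [mem_Ici] at ht hx
  obtain ⟨δ, hδ, C, hC, h⟩ := hs.exists_dist_le hF hx (t + 1)
  have h1 : Tendsto (fun q : ℝ × E n => s q.1 x) (𝓝[Ici 0 ×ˢ X] (t, x)) (𝓝 (s t x)) := by
    have h2 : Tendsto (fun q : ℝ × E n => q.1) (𝓝[Ici 0 ×ˢ X] (t, x)) (𝓝[Ici 0] t) :=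
      tendsto_nhdsWithin_iff.2 ⟨(continuous_fst.tendsto _).mono_left nhdsWithin_le_nhds,
        eventually_mem_nhdsWithin.mono fun q hq => hq.1⟩
    exact (hs.continuousOn hx t ht).tendsto.comp h2
  have h2 : Tendsto (fun q : ℝ × E n => dist (s q.1 q.2) (s q.1 x)) (𝓝[Ici 0 ×ˢ X] (t, x))
      (𝓝 0) := by
    have h3 : Tendsto (fun q : ℝ × E n => C * dist q.2 x) (𝓝[Ici 0 ×ˢ X] (t, x)) (𝓝 0) := by
      have : Continuous (fun q : ℝ × E n => C * dist q.2 x) := by fun_prop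
      simpa using (this.tendsto (t, x)).mono_left nhdsWithin_le_nhds
    refine squeeze_zero' (Eventually.of_forall fun _ => dist_nonneg) ?_ h3
    have e1 : ∀ᶠ q : ℝ × E n in 𝓝[Ici 0 ×ˢ X] (t, x), q.1 < t + 1 ∧ dist q.2 x < δ := by
      refine nhdsWithin_le_nhds (IsOpen.mem_nhds (s := {q : ℝ × E n | q.1 < t + 1 ∧ dist q.2 x < δ})
        ?_ ⟨by simp, by simpa using hδ⟩)
      exact (isOpen_lt continuous_fst continuous_const).inter
        (isOpen_lt (f := fun q : ℝ × E n => dist q.2 x) (by fun_prop) continuous_const)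
    filter_upwards [e1, eventually_mem_nhdsWithin] with q hq hq'
    exact h q.2 hq'.2 hq.2 q.1 ⟨hq'.1, hq.1.le⟩
  exact tendsto_of_tendsto_of_dist h1 (h2.congr fun q => dist_comm _ _)

end IsSolutionFlow

/-! ### The determinant and the linear variational equation -/

lemma det_eq_matrix (Y : E n →L[ℝ] E n) :
    Y.det = (Matrix.of fun i j => (Y (EuclideanSpace.single j 1)) i).det := by
  rw [ContinuousLinearMap.det, ← LinearMap.det_toMatrix (EuclideanSpace.basisFun (Fin n) ℝ).toBasis]
  congr 1

lemma differentiable_det : Differentiable ℝ fun Y : E n →L[ℝ] E n => Y.det := by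
  simp_rw [det_eq_matrix, Matrix.det_apply, Matrix.of_apply]
  have h : ∀ i j : Fin n, Differentiable ℝ fun Y : E n →L[ℝ] E n =>
      (Y (EuclideanSpace.single j 1)) i := fun i j => by fun_prop
  fun_prop

lemma hasDerivAt_det_one_add (A : E n →L[ℝ] E n) :
    HasDerivAt (fun r : ℝ => (1 + r • A).det) (∑ i, (A (EuclideanSpace.single i 1)) i) 0 := by
  have h : ∀ r : ℝ, (1 + r • A).det = (1 + r •
      (Matrix.of fun i j => (A (EuclideanSpace.single j 1)) i)).det := fun r => by
    rw [det_eq_matrix]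
    congr 1
    ext i j
    simp [Matrix.one_apply]
  simp only [h]
  rw [funext fun r : ℝ => Matrix.det_one_add_smul r _]
  set M := (Matrix.of fun i j => (A (EuclideanSpace.single j 1)) i)
  have h1 : HasDerivAt (fun r : ℝ => 1 + M.trace * r) M.trace 0 := by
    simpa using ((hasDerivAt_id (0 : ℝ)).const_mul M.trace).const_add 1
  have h2 := ((Matrix.det (1 + (Polynomial.X : Polynomial ℝ) •
    M.map Polynomial.C)).divX.divX.hasDerivAt (0 : ℝ)).fun_mul ((hasDerivAt_id' (0 : ℝ)).fun_pow 2)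
  have h3 := h1.fun_add h2
  simpa [Matrix.trace, M] using h3

/-- **Jacobi's formula** along a solution of the linear equation `Y' = A Y`. -/
lemma hasDerivWithinAt_det {Y : ℝ → E n →L[ℝ] E n} {A : E n →L[ℝ] E n} {S : Set ℝ} {t : ℝ}
    (hY : HasDerivWithinAt Y (A ∘L Y t) S t) :
    HasDerivWithinAt (fun τ => (Y τ).det)
      ((∑ i, (A (EuclideanSpace.single i 1)) i) * (Y t).det) S t := by
  have hd := (differentiable_det (Y t)).hasFDerivAt
  have h1 := hd.comp_hasDerivWithinAt t hY
  -- the derivative of `det` at `Y` in direction `A Y` is read off from `(1 + r A) Y`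
  have h2 : HasDerivAt (fun r : ℝ => Y t + r • (A ∘L Y t)) (A ∘L Y t) 0 := by
    simpa using ((hasDerivAt_id (0 : ℝ)).smul_const (A ∘L Y t)).const_add (Y t)
  have h3 := HasFDerivAt.comp_hasDerivAt_of_eq (0 : ℝ) hd h2 (by ext; simp)
  have h4 : HasDerivAt (fun r : ℝ => (Y t + r • (A ∘L Y t)).det)
      ((∑ i, (A (EuclideanSpace.single i 1)) i) * (Y t).det) 0 := by
    have := (hasDerivAt_det_one_add A).mul_const (Y t).det
    refine this.congr_of_eventuallyEq (Eventually.of_forall fun r => ?_)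
    have : Y t + r • (A ∘L Y t) = (1 + r • A) * Y t := by
      ext; simp
    simp only [this]
    exact LinearMap.det_comp _ _
  rw [← h3.unique h4]
  exact h1

/-- A linear equation `Y' = A(t) Y` has a fundamental solution on a short time interval. -/
lemma exists_fundamental_solution {V : Type*} [NormedAddCommGroup V] [NormedSpace ℝ V]
    [CompleteSpace V] {A : ℝ → V →L[ℝ] V} {T : ℝ} {K : NNReal} (hT : 0 ≤ T)
    (hA : ContinuousOn A (Icc 0 T)) (hK : ∀ t ∈ Icc 0 T, ‖A t‖ ≤ K) (hKT : K * T ≤ 1 / 2) :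
    ∃ Y : ℝ → V →L[ℝ] V, Y 0 = 1 ∧
      ∀ t ∈ Icc 0 T, HasDerivWithinAt Y (A t ∘L Y t) (Icc 0 T) t := by
  have hpl : IsPicardLindelof (fun t (Z : V →L[ℝ] V) => A t ∘L Z) (tmin := 0) (tmax := T)
      ⟨0, le_rfl, hT⟩ (1 : V →L[ℝ] V) 1 0 (2 * K) K := by
    refine ⟨fun t ht => ?_, fun Z _ => ?_, fun t ht Z hZ => ?_, ?_⟩
    · refine (LipschitzWith.of_dist_le_mul fun Z Z' => ?_).lipschitzOnWith
      rw [dist_eq_norm, dist_eq_norm, ← ContinuousLinearMap.comp_sub]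
      exact (ContinuousLinearMap.opNorm_comp_le _ _).trans
        (mul_le_mul_of_nonneg_right (hK t ht) (norm_nonneg _))
    · exact hA.clm_comp continuousOn_const
    · have h1 : ‖Z‖ ≤ 2 := by
        have h2 : ‖Z - 1‖ ≤ 1 := by simpa [dist_eq_norm] using hZ
        have h3 : ‖(1 : V →L[ℝ] V)‖ ≤ 1 := ContinuousLinearMap.norm_id_le
        have h4 := norm_add_le (Z - 1) 1
        rw [sub_add_cancel] at h4
        linarith
      calc ‖A t ∘L Z‖ ≤ ‖A t‖ * ‖Z‖ := ContinuousLinearMap.opNorm_comp_le _ _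
        _ ≤ K * 2 := mul_le_mul (hK t ht) h1 (norm_nonneg _) K.2
        _ = _ := by simp [mul_comm]
    · simp only [NNReal.coe_mul, NNReal.coe_ofNat, sub_zero, sub_self, NNReal.coe_one,
        NNReal.coe_zero, max_eq_left hT]
      linarith
  exact hpl.exists_eq_forall_mem_Icc_hasDerivWithinAt₀

/-! ### Liouville's formula for the flow -/

/-- First-order Taylor approximation of a `C¹` map, uniformly along a compact set. -/
lemma exists_uniform_linear_approx {U K : Set (E n)} (hU : IsOpen U)
    (hF : ContDiffOn ℝ 1 F U) (hK : IsCompact K) (hKU : K ⊆ U) {ε : ℝ} (hε : 0 < ε) :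
    ∃ δ > 0, ∀ z ∈ K, ∀ w, dist w z < δ →
      ‖F w - F z - fderiv ℝ F z (w - z)‖ ≤ ε * ‖w - z‖ := by
  obtain ⟨r, hr, hrU⟩ := hK.exists_cthickening_subset_open hU hKU
  have huc := hK.cthickening (r := r) |>.uniformContinuousOn_of_continuous
    ((hF.continuousOn_fderiv_of_isOpen hU le_rfl).mono hrU)
  obtain ⟨δ, hδ, h⟩ := Metric.uniformContinuousOn_iff.1 huc ε hε
  refine ⟨min δ r, lt_min hδ hr, fun z hz w hw => ?_⟩
  have hball : Metric.ball z (min δ r) ⊆ Metric.cthickening r K := fun y hy =>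
    Metric.mem_cthickening_of_dist_le _ z _ _ hz
      ((Metric.mem_ball.1 hy).le.trans (min_le_right _ _))
  refine (convex_ball z (min δ r)).norm_image_sub_le_of_norm_hasFDerivWithin_le'
    (f' := fun y => fderiv ℝ F y) (fun y hy => ?_) (fun y hy => ?_)
    (Metric.mem_ball_self (lt_min hδ hr)) hw
  · exact ((hF.contDiffAt (hU.mem_nhds (hrU (hball hy)))).differentiableAt
      one_ne_zero).hasFDerivAt.hasFDerivWithinAt
  · rw [← dist_eq_norm]
    exact (h y (hball hy) z (Metric.self_subset_cthickening _ hz)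
      ((Metric.mem_ball.1 hy).trans_le (min_le_left _ _))).le

/-- The fundamental theorem of calculus on the half-line `[0, ∞)`. -/
lemma hasDerivWithinAt_integral_of_continuousOn_Ici {a : ℝ → ℝ} (ha : ContinuousOn a (Ici 0))
    {t : ℝ} (ht : 0 ≤ t) :
    HasDerivWithinAt (fun u => ∫ τ in (0 : ℝ)..u, a τ) (a t) (Ici 0) t := by
  have hc : Continuous fun τ : ℝ => a (max 0 τ) :=
    ha.comp_continuous (by fun_prop) fun τ => mem_Ici.2 (le_max_left _ _)
  have h := (hc.integral_hasStrictDerivAt 0 t).hasDerivAt.hasDerivWithinAt (s := Ici 0)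
  rw [max_eq_right ht] at h
  have heq : ∀ u ∈ Ici (0 : ℝ), ∫ τ in (0 : ℝ)..u, a τ = ∫ τ in (0 : ℝ)..u, a (max 0 τ) := by
    intro u hu
    refine intervalIntegral.integral_congr fun τ hτ => ?_
    rw [uIcc_of_le hu] at hτ
    simp only [max_eq_right hτ.1]
  exact h.congr heq (heq t ht)

lemma intervalIntegrable_of_continuousOn_Ici {a : ℝ → ℝ} (ha : ContinuousOn a (Ici 0))
    {b c : ℝ} (hb : 0 ≤ b) (hc : 0 ≤ c) : IntervalIntegrable a volume b c :=
  (ha.mono fun _ hτ => (le_min hb hc).trans hτ.1).intervalIntegrable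

/-- Liouville's expression `exp ∫₀ᵗ (∇·F)(s_τ(x)) dτ` for the Jacobian determinant of the
flow `s_t` of `F`. -/
noncomputable def flowJacobian (F : E n → E n) (s : ℝ → E n → E n) (t : ℝ) (x : E n) : ℝ :=
  Real.exp (∫ τ in (0 : ℝ)..t, divergence F (s τ x))

lemma flowJacobian_pos (t : ℝ) (x : E n) : 0 < flowJacobian F s t x := Real.exp_pos _

@[simp] lemma flowJacobian_zero (x : E n) : flowJacobian F s 0 x = 1 := by simp [flowJacobian]

namespace IsSolutionFlow

lemma continuousOn_comp (hs : IsSolutionFlow F X s) {G : Type*} [TopologicalSpace G] {φ : E n → G}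
    (hφ : ContinuousOn φ X) {x : E n} (hx : x ∈ X) :
    ContinuousOn (fun τ => φ (s τ x)) (Ici 0) :=
  hφ.comp (hs.continuousOn hx) fun _ hτ => hs.mem hx hτ

lemma hasDerivWithinAt_flowJacobian (hs : IsSolutionFlow F X s) (hF : C1On F X) {x : E n}
    (hx : x ∈ X) {t : ℝ} (ht : 0 ≤ t) :
    HasDerivWithinAt (fun τ => flowJacobian F s τ x)
      (flowJacobian F s t x * divergence F (s t x)) (Ici 0) t :=
  (hasDerivWithinAt_integral_of_continuousOn_Ici
    (hs.continuousOn_comp hF.continuousOn_divergence hx) ht).exp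

lemma continuousOn_flowJacobian (hs : IsSolutionFlow F X s) (hF : C1On F X) {x : E n}
    (hx : x ∈ X) : ContinuousOn (fun τ => flowJacobian F s τ x) (Ici 0) :=
  fun _ ht => (hs.hasDerivWithinAt_flowJacobian hF hx ht).continuousWithinAt

lemma flowJacobian_add (hs : IsSolutionFlow F X s) (hF : C1On F X) {x : E n} (hx : x ∈ X)
    {a b : ℝ} (ha : 0 ≤ a) (hb : 0 ≤ b) :
    flowJacobian F s (a + b) x = flowJacobian F s a (s b x) * flowJacobian F s b x := by
  have hc := hs.continuousOn_comp hF.continuousOn_divergence hx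
  rw [flowJacobian, flowJacobian, flowJacobian, ← Real.exp_add]
  congr 1
  have h1 : ∫ τ in (0 : ℝ)..a, divergence F (s τ (s b x)) =
      ∫ τ in (0 : ℝ)..a, divergence F (s (τ + b) x) := by
    refine intervalIntegral.integral_congr fun τ hτ => ?_
    rw [uIcc_of_le ha] at hτ
    simp only [hs.add hF hx hτ.1 hb]
  rw [h1, intervalIntegral.integral_comp_add_right (fun τ => divergence F (s τ x)) b, add_comm,
    zero_add, add_comm (∫ τ in b..b + a, _), intervalIntegral.integral_add_adjacent_intervals
      (intervalIntegrable_of_continuousOn_Ici hc le_rfl hb)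
      (intervalIntegrable_of_continuousOn_Ici hc hb (add_nonneg hb ha))]

/-- The flow is differentiable on `X`, with the Jacobian determinant given by Liouville's formula,
over a time so short that the variational equation is solved by one application of the
Picard–Lindelöf theorem. -/
lemma exists_hasFDerivWithinAt_of_short (hs : IsSolutionFlow F X s) (hF : C1On F X) {x : E n}
    (hx : x ∈ X) {T : ℝ} (hT : 0 ≤ T) {K : NNReal}
    (hK : ∀ t ∈ Icc 0 T, ‖fderiv ℝ F (s t x)‖ ≤ K) (hKT : K * T ≤ 1 / 2) :
    ∃ Y : E n →L[ℝ] E n, HasFDerivWithinAt (s T) Y X x ∧ Y.det = flowJacobian F s T x := by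
  obtain ⟨U, hU, hXU, hFU⟩ := id hF
  have hAc : ContinuousOn (fun τ => fderiv ℝ F (s τ x)) (Icc 0 T) :=
    (hs.continuousOn_comp ((hFU.continuousOn_fderiv_of_isOpen hU le_rfl).mono hXU) hx).mono
      Icc_subset_Ici_self
  obtain ⟨Y, hY0, hY⟩ := exists_fundamental_solution hT hAc hK hKT
  have hYc : ContinuousOn Y (Icc 0 T) := fun t ht => (hY t ht).continuousWithinAt
  have hYr : ∀ t ∈ Ico 0 T, HasDerivWithinAt Y (fderiv ℝ F (s t x) ∘L Y t) (Ici t) t :=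
    fun t ht => (hY t ⟨ht.1, ht.2.le⟩).mono_of_mem_nhdsWithin
      (mem_of_superset (Icc_mem_nhdsGE ht.2) (Icc_subset_Icc_left ht.1))
  refine ⟨Y T, ?_, ?_⟩
  · rw [hasFDerivWithinAt_iff_isLittleO, Asymptotics.isLittleO_iff]
    intro c hc
    obtain ⟨δ₁, hδ₁, C, hC, hdist⟩ := hs.exists_dist_le hF hx T
    set B := Real.exp ((K + 1) * T) with hB
    have hBpos : 0 < B := Real.exp_pos _
    have hK1 : (0 : ℝ) < K + 1 := by positivity
    have hε : 0 < c * (K + 1) / (C * B) := by positivity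
    obtain ⟨δ₂, hδ₂, happ⟩ := exists_uniform_linear_approx hU hFU (hs.isCompact_orbit hx T)
      ((hs.orbit_subset hx T).trans hXU) hε
    have hev : ∀ᶠ y in 𝓝[X] x, dist y x < min δ₁ (δ₂ / C) :=
      nhdsWithin_le_nhds (Metric.ball_mem_nhds x (lt_min hδ₁ (by positivity)))
    filter_upwards [hev, eventually_mem_nhdsWithin] with y hyd hy
    have hyd1 := hyd.trans_le (min_le_left _ _)
    have hyd2 : C * dist y x < δ₂ := by
      have := hyd.trans_le (min_le_right _ _)
      rwa [lt_div_iff₀ hC, mul_comm] at this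
    -- the difference of the trajectories is an approximate solution of the variational equation
    have hgr := dist_le_of_approx_trajectories_ODE_of_mem
      (v := fun t (z : E n) => fderiv ℝ F (s t x) z) (s := fun _ => univ) (K := K + 1)
      (a := 0) (b := T) (f := fun τ => s τ y - s τ x) (g := fun τ => Y τ (y - x))
      (f' := fun τ => F (s τ y) - F (s τ x))
      (g' := fun τ => fderiv ℝ F (s τ x) (Y τ (y - x)))
      (εf := c * (K + 1) / (C * B) * (C * dist y x)) (εg := 0) (δ := 0)
      (fun t ht => by
        refine (((fderiv ℝ F (s t x)).lipschitz).weaken ?_).lipschitzOnWith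
        have := hK t ⟨ht.1, ht.2.le⟩
        rw [← NNReal.coe_le_coe]
        push_cast
        linarith)
      (((hs.continuousOn hy).sub (hs.continuousOn hx)).mono Icc_subset_Ici_self)
      (fun t ht => (hs.hasDerivWithinAt_Ici hy ht.1).sub (hs.hasDerivWithinAt_Ici hx ht.1))
      (fun t ht => by
        have h1 := hdist y hy hyd1 t ⟨ht.1, ht.2.le⟩
        rw [dist_eq_norm]
        refine (happ _ ⟨t, ⟨ht.1, ht.2.le⟩, rfl⟩ _ (h1.trans_lt hyd2)).trans ?_
        rw [← dist_eq_norm]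
        exact mul_le_mul_of_nonneg_left h1 hε.le)
      (fun _ _ => mem_univ _)
      (hYc.clm_apply continuousOn_const)
      (fun t ht => by simpa using (hYr t ht).clm_apply (hasDerivWithinAt_const t (Ici t) (y - x)))
      (fun t ht => by simp) (fun _ _ => mem_univ _)
      (by simp [hs.zero hx, hs.zero hy, hY0]) T ⟨hT, le_rfl⟩
    rw [dist_eq_norm, NNReal.coe_add, NNReal.coe_one, gronwallBound_of_K_ne_0 hK1.ne', sub_zero,
      add_zero] at hgr
    beta_reduce at hgr
    rw [zero_mul, zero_add, ← hB, dist_eq_norm] at hgr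
    refine hgr.trans ?_
    have : c * (K + 1) / (C * B) * (C * ‖y - x‖) / (K + 1) * (B - 1) =
        c * ‖y - x‖ * ((B - 1) / B) := by
      field_simp
    rw [this]
    refine mul_le_of_le_one_right (by positivity) ?_
    rw [div_le_one hBpos]; linarith
  · have hJ : ∀ t ∈ Ico 0 T, HasDerivWithinAt (fun τ => flowJacobian F s τ x)
        (flowJacobian F s t x * divergence F (s t x)) (Ici t) t := fun t ht =>
      (hs.hasDerivWithinAt_flowJacobian hF hx ht.1).mono (Ici_subset_Ici.2 ht.1)
    have hconst := constant_of_has_deriv_right_zero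
      (f := fun t => (Y t).det / flowJacobian F s t x) (a := 0) (b := T)
      ((differentiable_det.continuous.comp_continuousOn hYc).div
        ((hs.continuousOn_flowJacobian hF hx).mono Icc_subset_Ici_self)
        fun t _ => (flowJacobian_pos t x).ne')
      (fun t ht => by
        have := (hasDerivWithinAt_det (hYr t ht)).fun_div (hJ t ht) (flowJacobian_pos t x).ne'
        refine this.congr_deriv ?_
        rw [divergence]
        ring) T ⟨hT, le_rfl⟩
    simp only [hY0, flowJacobian_zero] at hconst
    have h1 : (1 : E n →L[ℝ] E n).det = 1 := LinearMap.det_id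
    rw [h1, div_one, div_eq_one_iff_eq (flowJacobian_pos T x).ne'] at hconst
    exact hconst

/-- **Liouville's formula**: the flow is differentiable on `X`, and its Jacobian determinant is
`exp ∫₀ᵗ (∇·F)(s_τ(x)) dτ`. -/
theorem exists_hasFDerivWithinAt (hs : IsSolutionFlow F X s) (hF : C1On F X) {x : E n}
    (hx : x ∈ X) {T : ℝ} (hT : 0 ≤ T) :
    ∃ Y : E n →L[ℝ] E n, HasFDerivWithinAt (s T) Y X x ∧ Y.det = flowJacobian F s T x := by
  obtain ⟨U, hU, hXU, hFU⟩ := id hF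
  have hAc : ContinuousOn (fun τ => fderiv ℝ F (s τ x)) (Icc 0 T) :=
    (hs.continuousOn_comp ((hFU.continuousOn_fderiv_of_isOpen hU le_rfl).mono hXU) hx).mono
      Icc_subset_Ici_self
  obtain ⟨K', hK'⟩ := isCompact_Icc.exists_bound_of_continuousOn hAc
  obtain ⟨K, hK⟩ : ∃ K : NNReal, ∀ t ∈ Icc 0 T, ‖fderiv ℝ F (s t x)‖ ≤ K :=
    ⟨K'.toNNReal, fun t ht => (hK' t ht).trans (Real.le_coe_toNNReal _)⟩
  obtain ⟨m, hm⟩ := exists_nat_gt (2 * (K * T))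
  have hm0 : (0 : ℝ) < m := (by positivity : (0 : ℝ) ≤ 2 * (K * T)).trans_lt hm
  -- split `[0, T]` into `m` short intervals
  have hσ : 0 ≤ T / m := by positivity
  have step : ∀ j : ℕ, j ≤ m → ∃ Y : E n →L[ℝ] E n,
      HasFDerivWithinAt (s (j * (T / m))) Y X x ∧ Y.det = flowJacobian F s (j * (T / m)) x := by
    intro j
    induction j with
    | zero =>
      intro _
      refine ⟨1, ?_, ?_⟩
      · refine (hasFDerivWithinAt_id x X).congr (fun y hy => ?_) ?_
        · simp [hs.zero hy]
        · simp [hs.zero hx]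
      · simp only [Nat.cast_zero, zero_mul, flowJacobian_zero]
        exact LinearMap.det_id
    | succ j ih =>
      intro hj
      obtain ⟨Y, hY, hdet⟩ := ih (Nat.le_of_succ_le hj)
      have hb : 0 ≤ j * (T / m) := by positivity
      have hsum : ((j + 1 : ℕ) : ℝ) * (T / m) = T / m + j * (T / m) := by push_cast; ring
      have hle : T / m + j * (T / m) ≤ T := by
        rw [← hsum]
        calc ((j + 1 : ℕ) : ℝ) * (T / m) ≤ m * (T / m) :=
              mul_le_mul_of_nonneg_right (Nat.cast_le.2 hj) hσ
          _ = T := by field_simp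
      obtain ⟨Z, hZ, hZdet⟩ := hs.exists_hasFDerivWithinAt_of_short hF (hs.mem hx hb) hσ (K := K)
        (fun t ht => by
          rw [← hs.add hF hx ht.1 hb]
          exact hK _ ⟨add_nonneg ht.1 hb, by linarith [ht.2]⟩)
        (by
          rw [← mul_div_assoc, div_le_iff₀ hm0]; linarith)
      refine ⟨Z ∘L Y, ?_, ?_⟩
      · rw [hsum]
        exact (hZ.comp x hY fun y hy => hs.mem hy hb).congr
          (fun y hy => hs.add hF hy hσ hb) (hs.add hF hx hσ hb)
      · rw [hsum, hs.flowJacobian_add hF hx hσ hb, ← hZdet, ← hdet]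
        exact LinearMap.det_comp _ _
  have := step m le_rfl
  rwa [mul_div_cancel₀ _ hm0.ne'] at this

end IsSolutionFlow

/-! ### Change of variables under the flow -/

/-- `X₁` is a Borel part of the state space `X` of the flow `s` of `F` that no trajectory re-enters
after having left it. The map `(t, x) ↦ s t x` is assumed to be Borel on all of `ℝ × ℝⁿ`; this only
concerns its arbitrary values at negative times and outside `X`. -/
structure IsTransient (F : E n → E n) (X X₁ : Set (E n)) (s : ℝ → E n → E n) : Prop where
  flow : IsSolutionFlow F X s
  c1On : C1On F X
  measurableSet : MeasurableSet X
  measurable : Measurable fun q : ℝ × E n => s q.1 q.2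
  measurableSet₁ : MeasurableSet X₁
  subset : X₁ ⊆ X
  not_reenter : ∀ x ∈ X, ∀ a b : ℝ, 0 ≤ a → a ≤ b → s b x ∈ X₁ → s a x ∈ X₁

/-- Joint measurability in `(t, x)`, as needed for Tonelli's theorem. -/
lemma measurable_flowJacobian (hs : Measurable fun q : ℝ × E n => s q.1 q.2) :
    Measurable fun q : ℝ × E n => flowJacobian F s q.1 q.2 := by
  refine Real.measurable_exp.comp ?_
  have hg : Measurable fun r : (ℝ × E n) × ℝ => divergence F (s r.2 r.1.2) :=
    measurable_divergence.comp (hs.comp (measurable_snd.prodMk measurable_fst.snd))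
  have key : ∀ S : Set ((ℝ × E n) × ℝ), MeasurableSet S → Measurable fun q : ℝ × E n =>
      ∫ τ, S.indicator (fun r : (ℝ × E n) × ℝ => divergence F (s r.2 r.1.2)) (q, τ) :=
    fun S hS => (hg.indicator hS).stronglyMeasurable.integral_prod_right'.measurable
  have h1 := key {r | 0 < r.2 ∧ r.2 ≤ r.1.1}
    ((measurableSet_lt measurable_const measurable_snd).inter
      (measurableSet_le measurable_snd measurable_fst.fst))
  have h2 := key {r | r.1.1 < r.2 ∧ r.2 ≤ 0}
    ((measurableSet_lt measurable_fst.fst measurable_snd).inter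
      (measurableSet_le measurable_snd measurable_const))
  convert h1.sub h2 using 2 with q
  simp only [Pi.sub_apply]
  rw [intervalIntegral, ← integral_indicator measurableSet_Ioc,
    ← integral_indicator measurableSet_Ioc]
  rfl

lemma initMeasure_apply {h₀ : E n → ℝ} {S : Set (E n)}
    (hS : MeasurableSet S) (hSX : S ⊆ X) :
    initMeasure X h₀ S = ∫⁻ x in S, ENNReal.ofReal (h₀ x) := by
  rw [initMeasure, withDensity_apply _ hS, Measure.restrict_restrict hS,
    inter_eq_left.2 hSX]

lemma isFiniteMeasure_initMeasure {h₀ : E n → ℝ} (hint : IntegrableOn h₀ X volume) :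
    IsFiniteMeasure (initMeasure X h₀) := by
  refine isFiniteMeasure_withDensity (ne_of_lt ?_)
  exact (lintegral_mono fun x => Real.ofReal_le_enorm (h₀ x)).trans_lt hint.2

lemma initMeasure_absolutelyContinuous (h₀ : E n → ℝ) :
    initMeasure X h₀ ≪ volume.restrict X := withDensity_absolutelyContinuous _ _

lemma ae_initMeasure_iff {h₀ : E n → ℝ} (hh₀ : Measurable h₀) {P : E n → Prop} :
    (∀ᵐ x ∂(initMeasure X h₀), P x) ↔ ∀ᵐ x ∂(volume.restrict X), 0 < h₀ x → P x := by
  rw [initMeasure, ae_withDensity_iff hh₀.ennreal_ofReal]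
  simp

namespace IsTransient

lemma measurable_apply (h : IsTransient F X X₁ s) (t : ℝ) : Measurable (s t) :=
  h.measurable.comp measurable_prodMk_left

lemma measurableSet_image (h : IsTransient F X X₁ s) {t : ℝ} (ht : 0 ≤ t) {A : Set (E n)}
    (hA : MeasurableSet A) (hAX : A ⊆ X) : MeasurableSet (s t '' A) := by
  choose! Y hY _ using fun x (hx : x ∈ X) => h.flow.exists_hasFDerivWithinAt h.c1On hx ht
  exact measurable_image_of_fderivWithin hA (fun x hx => (hY x (hAX hx)).mono hAX)
    ((h.flow.injOn h.c1On ht).mono hAX)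

/-- Change of variables under the flow. -/
lemma lintegral_image (h : IsTransient F X X₁ s) {t : ℝ} (ht : 0 ≤ t) {A : Set (E n)}
    (hA : MeasurableSet A) (hAX : A ⊆ X) (φ : E n → ENNReal) :
    ∫⁻ y in s t '' A, φ y = ∫⁻ x in A, ENNReal.ofReal (flowJacobian F s t x) * φ (s t x) := by
  choose! Y hY hdet using fun x (hx : x ∈ X) => h.flow.exists_hasFDerivWithinAt h.c1On hx ht
  rw [lintegral_image_eq_lintegral_abs_det_fderiv_mul volume hA
    (fun x hx => (hY x (hAX hx)).mono hAX) ((h.flow.injOn h.c1On ht).mono hAX)]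
  refine setLIntegral_congr_fun hA fun x hx => ?_
  simp only [hdet x (hAX hx), abs_of_pos (flowJacobian_pos t x)]

/-- Preimages of Lebesgue-null sets under the flow are null, its Jacobian determinant being
positive. -/
lemma ae_notMem (h : IsTransient F X X₁ s) {t : ℝ} (ht : 0 ≤ t) {Z : Set (E n)}
    (hZ : volume Z = 0) : ∀ᵐ x ∂(volume.restrict X), s t x ∉ Z := by
  set A := X ∩ s t ⁻¹' (toMeasurable volume Z) with hA
  have hAm : MeasurableSet A :=
    h.measurableSet.inter (h.measurable_apply t (measurableSet_toMeasurable _ _))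
  have h1 : ∫⁻ y in s t '' A, 1 = 0 := by
    rw [setLIntegral_one]
    refine measure_mono_null ?_ ((measure_toMeasurable Z).trans hZ)
    rintro _ ⟨x, hx, rfl⟩
    exact hx.2
  rw [h.lintegral_image ht hAm inter_subset_left, lintegral_eq_zero_iff] at h1
  · have h2 : ∀ᵐ x ∂(volume.restrict A), False := by
      filter_upwards [h1] with x hx
      simp [not_le.2 (flowJacobian_pos t x)] at hx
    have h3 : volume A = 0 := by
      simpa [ae_iff] using h2
    rw [ae_restrict_iff' h.measurableSet, ae_iff]
    refine measure_mono_null (fun x hx => ?_) h3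
    simp only [mem_ofPred_eq, Classical.not_imp, not_not] at hx
    exact ⟨hx.1, subset_toMeasurable _ _ hx.2⟩
  · exact ((measurable_flowJacobian h.measurable).comp
      measurable_prodMk_left).ennreal_ofReal.mul_const 1

/-- Almost every trajectory spends no time in a given Lebesgue-null set. -/
lemma ae_ae_notMem (h : IsTransient F X X₁ s) {Z : Set (E n)} (hZ : volume Z = 0) :
    ∀ᵐ x ∂(volume.restrict X), ∀ᵐ τ ∂(volume.restrict (Ioi (0 : ℝ))), s τ x ∉ Z := by
  have h1 : ∀ᵐ τ ∂(volume.restrict (Ioi (0 : ℝ))), ∀ᵐ x ∂(volume.restrict X),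
      s τ x ∉ toMeasurable volume Z := by
    filter_upwards [ae_restrict_mem measurableSet_Ioi] with τ hτ
    exact h.ae_notMem (mem_Ioi.1 hτ).le ((measure_toMeasurable Z).trans hZ)
  rw [Measure.ae_ae_comm
    (h.measurable (measurableSet_toMeasurable volume Z)).compl] at h1
  filter_upwards [h1] with x hx
  filter_upwards [hx] with τ hτ hτ'
  exact hτ (subset_toMeasurable _ _ hτ')

end IsTransient

/-- The points of `X₁` that are reached from `X₁` in time `t`. -/
def reached (X₁ : Set (E n)) (s : ℝ → E n → E n) (t : ℝ) : Set (E n) := X₁ ∩ s t '' X₁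

namespace IsTransient

lemma measurableSet_reached (h : IsTransient F X X₁ s) {t : ℝ} (ht : 0 ≤ t) :
    MeasurableSet (reached X₁ s t) :=
  h.measurableSet₁.inter (h.measurableSet_image ht h.measurableSet₁ h.subset)

lemma mem_reached_of_le (h : IsTransient F X X₁ s) {a b : ℝ} (ha : 0 ≤ a) (hab : a ≤ b) {x : E n}
    (hx : x ∈ X) (hb : s b x ∈ X₁) : s b x ∈ reached X₁ s a := by
  refine ⟨hb, s (b - a) x, ?_, ?_⟩
  · exact h.not_reenter x hx _ _ (by linarith) (by linarith) hb
  · rw [← h.flow.add h.c1On hx ha (by linarith)]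
    congr 1; ring

lemma reached_anti (h : IsTransient F X X₁ s) {a b : ℝ} (ha : 0 ≤ a) (hab : a ≤ b) :
    reached X₁ s b ⊆ reached X₁ s a := by
  rintro _ ⟨hy, x, hx, rfl⟩
  exact h.mem_reached_of_le ha hab (h.subset hx) hy

/-- Almost every point of `X₁` is reached from `X₁` in some positive time: the images under the
flow of the set of exceptional points are pairwise disjoint, so at small times their measures tend
to `0`, although these measures are nearly that of the exceptional set itself. -/
lemma volume_diff_iUnion_reached (h : IsTransient F X X₁ s) :
    volume (X₁ \ ⋃ m : ℕ, reached X₁ s (1 / (m + 1 : ℝ))) = 0 := by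
  set t : ℕ → ℝ := fun m => 1 / (m + 1 : ℝ) with ht
  have htpos : ∀ m, 0 < t m := fun m => Nat.one_div_pos_of_nat
  have htanti : ∀ {i j}, i < j → t j < t i := fun hij => by
    simp only [ht]
    exact one_div_lt_one_div_of_lt (by positivity) (by exact_mod_cast Nat.succ_lt_succ hij)
  set D := X₁ \ ⋃ m : ℕ, reached X₁ s (t m) with hD
  have hDm : MeasurableSet D := h.measurableSet₁.diff
    (MeasurableSet.iUnion fun m => h.measurableSet_reached (htpos m).le)
  have hDX : D ⊆ X := sdiff_subset.trans h.subset
  have hdisj : Pairwise (Function.onFun Disjoint fun m => s (t m) '' D) := by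
    have key : ∀ i j, i < j → Disjoint (s (t i) '' D) (s (t j) '' D) := by
      intro i j hij
      rw [Set.disjoint_left]
      rintro _ ⟨x, hx, rfl⟩ ⟨y, hy, hxy⟩
      have hpos : 0 < t i - t j := sub_pos.2 (htanti hij)
      have e : s (t j) y = s (t j) (s (t i - t j) x) := by
        rw [hxy, ← h.flow.add h.c1On (hDX hx) (htpos j).le hpos.le]
        congr 1; ring
      have e' : y = s (t i - t j) x :=
        h.flow.injOn h.c1On (htpos j).le (hDX hy) (h.flow.mem (hDX hx) hpos.le) e
      obtain ⟨m, hm⟩ := exists_nat_one_div_lt hpos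
      refine hy.2 (mem_iUnion.2 ⟨m, ?_⟩)
      rw [e']
      exact h.mem_reached_of_le (htpos m).le hm.le (hDX hx) (e' ▸ hy.1)
    intro i j hij
    rcases lt_or_gt_of_ne hij with hlt | hlt
    · exact key i j hlt
    · exact (key j i hlt).symm
  -- a continuous, positive and integrable weight
  set w : E n → ENNReal := fun x => ENNReal.ofReal ((1 + ‖x‖) ^ (-(n + 1 : ℝ))) with hw
  have hwc : Continuous w := by
    refine ENNReal.continuous_ofReal.comp ?_
    refine (by fun_prop : Continuous fun x : E n => 1 + ‖x‖).rpow_const fun x => Or.inl ?_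
    positivity
  have hwint : ∫⁻ x, w x ≠ ⊤ := by
    refine (finite_integral_one_add_norm ?_).ne
    simp
  have hsum : ∑' m, ∫⁻ y in s (t m) '' D, w y ≠ ⊤ := by
    rw [← lintegral_iUnion (fun m => h.measurableSet_image (htpos m).le hDm hDX) hdisj]
    exact ne_top_of_le_ne_top hwint (setLIntegral_le_lintegral _ _)
  have hlim := ENNReal.tendsto_atTop_zero_of_tsum_ne_top hsum
  simp_rw [fun m => h.lintegral_image (htpos m).le hDm hDX w] at hlim
  have ht0 : Tendsto t atTop (𝓝[Ici 0] 0) := tendsto_nhdsWithin_iff.2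
    ⟨tendsto_one_div_add_atTop_nhds_zero_nat, Eventually.of_forall fun m => (htpos m).le⟩
  have hpt : ∀ x ∈ D, liminf (fun m => ENNReal.ofReal (flowJacobian F s (t m) x) *
      w (s (t m) x)) atTop = w x := by
    intro x hx
    refine Tendsto.liminf_eq ?_
    have h1 := ((h.flow.continuousOn_flowJacobian h.c1On (hDX hx)) 0 self_mem_Ici).tendsto.comp ht0
    have h2 := ((h.flow.continuousOn (hDX hx)) 0 self_mem_Ici).tendsto.comp ht0
    have h3 := ENNReal.Tendsto.mul (ENNReal.tendsto_ofReal h1) (Or.inl ?_)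
      ((hwc.tendsto _).comp h2) (Or.inr ENNReal.ofReal_ne_top)
    · simpa [h.flow.zero (hDX hx)] using h3
    · simp
  have hzero : ∫⁻ x in D, w x = 0 := by
    rw [← nonpos_iff_eq_zero, ← hlim.liminf_eq,
      ← setLIntegral_congr_fun hDm hpt]
    refine lintegral_liminf_le fun m => ?_
    exact ((measurable_flowJacobian h.measurable).comp
      measurable_prodMk_left).ennreal_ofReal.mul (hwc.measurable.comp (h.measurable_apply _))
  rw [lintegral_eq_zero_iff hwc.measurable] at hzero
  have h2 : ∀ᵐ x ∂(volume.restrict D), False := by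
    filter_upwards [hzero] with x hx
    have : 0 < (1 + ‖x‖) ^ (-(n + 1 : ℝ)) := by positivity
    simp only [hw, Pi.zero_apply, ENNReal.ofReal_eq_zero] at hx
    linarith
  simpa [ae_iff] using h2

end IsTransient

/-! ### Transport of densities along trajectories -/

namespace IsTransient

lemma mem_of_le (h : IsTransient F X X₁ s) {x : E n} (hx : x ∈ X) {t τ : ℝ} (hτ : τ ∈ Icc 0 t)
    (hxt : s t x ∈ X₁) : s τ x ∈ X₁ := h.not_reenter x hx τ t hτ.1 hτ.2 hxt

lemma continuousOn_flux (h : IsTransient F X X₁ s) {ρ : E n → ℝ} (hρ : C1On ρ X₁) {x : E n}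
    (hx : x ∈ X) {t : ℝ} (hxt : s t x ∈ X₁) :
    ContinuousOn (fun τ => flowJacobian F s τ x * divergence (fun y => ρ y • F y) (s τ x))
      (Icc 0 t) := by
  refine ((h.flow.continuousOn_flowJacobian h.c1On hx).mono Icc_subset_Ici_self).mul ?_
  exact (hρ.smul (h.c1On.mono h.subset)).continuousOn_divergence.comp
    ((h.flow.continuousOn hx).mono Icc_subset_Ici_self) fun τ hτ => h.mem_of_le hx hτ hxt

/-- Along a trajectory, the density transported by the flow grows at the rate
`∇·(ρ F)`, weighted by the Jacobian determinant. -/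
lemma density_transport (h : IsTransient F X X₁ s) {ρ : E n → ℝ} (hρ : C1On ρ X₁) {x : E n}
    (hx : x ∈ X) {t : ℝ} (ht : 0 ≤ t) (hxt : s t x ∈ X₁) :
    ρ (s t x) * flowJacobian F s t x = ρ x +
      ∫ τ in (0 : ℝ)..t, flowJacobian F s τ x * divergence (fun y => ρ y • F y) (s τ x) := by
  have hderiv : ∀ τ ∈ Icc 0 t, HasDerivWithinAt (fun τ => ρ (s τ x) * flowJacobian F s τ x)
      (flowJacobian F s τ x * divergence (fun y => ρ y • F y) (s τ x)) (Ici 0) τ := by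
    intro τ hτ
    have hmem := h.mem_of_le hx hτ hxt
    have h1 := (hρ.differentiableAt hmem).hasFDerivAt.comp_hasDerivWithinAt τ
      (h.flow.hasDerivWithinAt hx hτ.1)
    refine (h1.mul (h.flow.hasDerivWithinAt_flowJacobian h.c1On hx hτ.1)).congr_deriv ?_
    rw [divergence_smul (hρ.differentiableAt hmem) (h.c1On.differentiableAt (h.subset hmem))]
    simp only [Function.comp_apply]
    ring
  rw [intervalIntegral.integral_eq_sub_of_hasDeriv_right_of_le ht
    (f := fun τ => ρ (s τ x) * flowJacobian F s τ x)
    (fun τ hτ => ((hderiv τ hτ).mono Icc_subset_Ici_self).continuousWithinAt)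
    (fun τ hτ => (hderiv τ ⟨hτ.1.le, hτ.2.le⟩).mono fun y (hy : τ < y) => hτ.1.le.trans hy.le)
    (ContinuousOn.intervalIntegrable (by
      rw [uIcc_of_le ht]; exact h.continuousOn_flux hρ hx hxt))]
  simp [h.flow.zero hx]

/-- If the flux `ρ F` has divergence `h₀` almost everywhere on `X₁`, the transported density is
determined along almost every trajectory by `h₀`. -/
lemma ae_density_transport (h : IsTransient F X X₁ s) {ρ h₀ : E n → ℝ} (hρ : C1On ρ X₁)
    (hρ0 : ∀ x ∈ X₁, 0 ≤ ρ x) (hh₀ : ∀ x, 0 ≤ h₀ x)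
    (hdiv : ∀ᵐ x ∂(volume.restrict X₁), divergence (fun y => ρ y • F y) x = h₀ x) :
    ∀ᵐ x ∂(volume.restrict X₁), ∀ t : ℝ, 0 ≤ t → s t x ∈ X₁ →
      ENNReal.ofReal (ρ (s t x) * flowJacobian F s t x) = ENNReal.ofReal (ρ x) +
        ∫⁻ τ in Ioo 0 t, ENNReal.ofReal (flowJacobian F s τ x * h₀ (s τ x)) := by
  rw [ae_restrict_iff' h.measurableSet₁, ae_iff] at hdiv
  filter_upwards [ae_restrict_of_ae_restrict_of_subset h.subset (h.ae_ae_notMem hdiv),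
    ae_restrict_mem h.measurableSet₁] with x hx hx₁ t ht hxt
  have hxX := h.subset hx₁
  have hae : ∀ᵐ τ ∂(volume.restrict (Ioo 0 t)),
      flowJacobian F s τ x * divergence (fun y => ρ y • F y) (s τ x) =
        flowJacobian F s τ x * h₀ (s τ x) := by
    filter_upwards [ae_restrict_of_ae_restrict_of_subset Ioo_subset_Ioi_self hx,
      ae_restrict_mem measurableSet_Ioo] with τ hτ hτ'
    simp only [not_not] at hτ
    rw [hτ (h.mem_of_le hxX ⟨hτ'.1.le, hτ'.2.le⟩ hxt)]
  have hint : IntegrableOn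
      (fun τ => flowJacobian F s τ x * divergence (fun y => ρ y • F y) (s τ x)) (Ioo 0 t) :=
    (h.continuousOn_flux hρ hxX hxt).integrableOn_Icc.mono_set Ioo_subset_Icc_self
  have hnn : ∀ τ, 0 ≤ flowJacobian F s τ x * h₀ (s τ x) := fun τ =>
    mul_nonneg (flowJacobian_pos τ x).le (hh₀ _)
  rw [h.density_transport hρ hxX ht hxt, intervalIntegral.integral_of_le ht,
    integral_Ioc_eq_integral_Ioo, integral_congr_ae hae, ENNReal.ofReal_add (hρ0 x hx₁)
      (integral_nonneg hnn), ofReal_integral_eq_lintegral_ofReal (hint.congr hae)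
      (Eventually.of_forall hnn)]

/-- Points of `X₁` that reach `s_T(A)`, `A ⊆ X₁`, at an intermediate time `t` are exactly those of
`s_{T-t}(A)`. -/
lemma setOf_mem_image (h : IsTransient F X X₁ s) {A : Set (E n)} (hA : A ⊆ X₁) {T : ℝ}
    (hAT : ∀ x ∈ A, s T x ∈ X₁) {t : ℝ} (ht : t ∈ Icc 0 T) :
    {x ∈ X₁ | s t x ∈ s T '' A} = s (T - t) '' A := by
  have hT : 0 ≤ T - t := sub_nonneg.2 ht.2
  have hadd : ∀ a ∈ A, s T a = s t (s (T - t) a) := fun a ha => by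
    rw [← h.flow.add h.c1On (h.subset (hA ha)) ht.1 hT]
    congr 1; ring
  ext x
  constructor
  · rintro ⟨hx, a, ha, hax⟩
    refine ⟨a, ha, ?_⟩
    rw [hadd a ha] at hax
    exact h.flow.injOn h.c1On ht.1 (h.flow.mem (h.subset (hA ha)) hT) (h.subset hx) hax
  · rintro ⟨a, ha, rfl⟩
    exact ⟨h.mem_of_le (h.subset (hA ha)) ⟨hT, by linarith [ht.1]⟩ (hAT a ha), a, ha, hadd a ha⟩

/-- The mass of `μ₀` that `s_T(A)` collects during the time interval `(0, T)`, in the coordinates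
of `A`. -/
lemma lintegral_initMeasure_image (h : IsTransient F X X₁ s) {h₀ : E n → ℝ} (hh₀ : Measurable h₀)
    {A : Set (E n)} (hAm : MeasurableSet A) (hA : A ⊆ X₁) {T : ℝ}
    (hAT : ∀ x ∈ A, s T x ∈ X₁) :
    ∫⁻ t in Ioo 0 T, initMeasure X h₀ {x ∈ X₁ | s t x ∈ s T '' A} =
      ∫⁻ x in A, ∫⁻ τ in Ioo 0 T, ENNReal.ofReal (flowJacobian F s τ x * h₀ (s τ x)) := by
  have hm : Measurable fun q : ℝ × E n =>
      ENNReal.ofReal (flowJacobian F s q.1 q.2 * h₀ (s q.1 q.2)) :=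
    ((measurable_flowJacobian h.measurable).mul (hh₀.comp h.measurable)).ennreal_ofReal
  set G : ℝ → ENNReal := fun τ =>
    ∫⁻ x in A, ENNReal.ofReal (flowJacobian F s τ x * h₀ (s τ x)) with hG
  have h1 : ∀ t ∈ Ioo 0 T, initMeasure X h₀ {x ∈ X₁ | s t x ∈ s T '' A} = G (T - t) := by
    intro t ht
    have hT : 0 ≤ T - t := sub_nonneg.2 ht.2.le
    have hAX := hA.trans h.subset
    rw [h.setOf_mem_image hA hAT ⟨ht.1.le, ht.2.le⟩, initMeasure_apply
      (h.measurableSet_image hT hAm hAX) (by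
        rintro _ ⟨a, ha, rfl⟩; exact h.flow.mem (hAX ha) hT), h.lintegral_image hT hAm hAX]
    simp_rw [hG, ENNReal.ofReal_mul (flowJacobian_pos _ _).le]
  rw [setLIntegral_congr_fun measurableSet_Ioo h1, lintegral_lintegral_swap
    (f := fun x τ => ENNReal.ofReal (flowJacobian F s τ x * h₀ (s τ x)))
    (hm.comp measurable_swap).aemeasurable, ← lintegral_indicator measurableSet_Ioo,
    ← lintegral_indicator measurableSet_Ioo, ← lintegral_sub_left_eq_self _ T]
  congr 1
  ext t
  by_cases ht : t ∈ Ioo 0 T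
  · rw [indicator_of_mem ht, indicator_of_mem (show T - t ∈ Ioo 0 T from
      ⟨by linarith [ht.2], by linarith [ht.1]⟩), sub_sub_cancel]
  · rw [indicator_of_notMem ht, indicator_of_notMem (show T - t ∉ Ioo 0 T from
      fun h' => ht ⟨by linarith [h'.2], by linarith [h'.1]⟩)]

lemma measurable_initMeasure_section (h : IsTransient F X X₁ s) {μ : Measure (E n)} [SFinite μ]
    {B R : Set (E n)} (hB : MeasurableSet B) (hR : MeasurableSet R) :
    Measurable fun t => μ ({x ∈ X₁ | s t x ∈ B} ∩ R) := by
  have hS : MeasurableSet {q : ℝ × E n | (q.2 ∈ X₁ ∧ s q.1 q.2 ∈ B) ∧ q.2 ∈ R} :=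
    ((measurable_snd h.measurableSet₁).inter (h.measurable hB)).inter (measurable_snd hR)
  exact measurable_measure_prodMk_left hS

end IsTransient

/-! ### The occupation measure -/

namespace IsTransient

/-- Up to time `T`, the occupation of a set `B` of points that are reached from `X₁` in time `T` is at
most `∫_B ρ`: such a set is `s_T(A)` for some `A ⊆ X₁`. -/
lemma occupation_le_of_subset_reached (h : IsTransient F X X₁ s) {ρ h₀ : E n → ℝ}
    (hρ : C1On ρ X₁) (hρ0 : ∀ x ∈ X₁, 0 ≤ ρ x) (hh₀m : Measurable h₀) (hh₀ : ∀ x, 0 ≤ h₀ x)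
    (hdiv : ∀ᵐ x ∂(volume.restrict X₁), divergence (fun y => ρ y • F y) x = h₀ x)
    {B : Set (E n)} (hB : MeasurableSet B) {T : ℝ} (hT : 0 ≤ T) (hBT : B ⊆ reached X₁ s T) :
    ∫⁻ t in Ioo 0 T, initMeasure X h₀ {x ∈ X₁ | s t x ∈ B} ≤
      ∫⁻ x in B, ENNReal.ofReal (ρ x) := by
  set A := X₁ ∩ s T ⁻¹' B with hA
  have hAm : MeasurableSet A := h.measurableSet₁.inter (h.measurable_apply T hB)
  have hAT : ∀ x ∈ A, s T x ∈ X₁ := fun x hx => (hBT hx.2).1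
  have hAX : A ⊆ X := inter_subset_left.trans h.subset
  have hBA : B = s T '' A := by
    ext y
    constructor
    · intro hy
      obtain ⟨x, hx, rfl⟩ := (hBT hy).2
      exact ⟨x, ⟨hx, hy⟩, rfl⟩
    · rintro ⟨x, hx, rfl⟩; exact hx.2
  rw [hBA, h.lintegral_initMeasure_image hh₀m hAm inter_subset_left hAT,
    h.lintegral_image hT hAm hAX]
  refine lintegral_mono_ae ?_
  filter_upwards [ae_restrict_of_ae_restrict_of_subset inter_subset_left
    (h.ae_density_transport hρ hρ0 hh₀ hdiv), ae_restrict_mem hAm] with x hx hxA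
  rw [← ENNReal.ofReal_mul (flowJacobian_pos _ _).le, mul_comm (flowJacobian F s T x),
    hx T hT (hAT x hxA)]
  exact le_add_self

/-- The occupation by the trajectories that start in points reached from `X₁` in time `δ`. A time
step `δ` splits off the part of `B` which is reached in time `(j + 1) δ`; the rest is not visited
after time `j δ`. -/
lemma occupation_inter_reached_le (h : IsTransient F X X₁ s) {ρ h₀ : E n → ℝ}
    (hρ : C1On ρ X₁) (hρ0 : ∀ x ∈ X₁, 0 ≤ ρ x) (hh₀m : Measurable h₀) (hh₀ : ∀ x, 0 ≤ h₀ x)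
    (hint : IntegrableOn h₀ X volume)
    (hdiv : ∀ᵐ x ∂(volume.restrict X₁), divergence (fun y => ρ y • F y) x = h₀ x)
    {δ : ℝ} (hδ : 0 < δ) (j : ℕ) {B : Set (E n)} (hB : MeasurableSet B) (hBX : B ⊆ X₁) :
    ∫⁻ t in Ioo 0 (j * δ), initMeasure X h₀ ({x ∈ X₁ | s t x ∈ B} ∩ reached X₁ s δ) ≤
      ∫⁻ x in B, ENNReal.ofReal (ρ x) := by
  have := isFiniteMeasure_initMeasure hint
  induction j generalizing B with
  | zero => simp
  | succ j ih =>
    set T := ((j + 1 : ℕ) : ℝ) * δ with hTdef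
    have hT : 0 ≤ T := by positivity
    have hTj : T = j * δ + δ := by rw [hTdef]; push_cast; ring
    set R := reached X₁ s T with hRdef
    have hR : MeasurableSet R := h.measurableSet_reached hT
    have hRδ : MeasurableSet (reached X₁ s δ) := h.measurableSet_reached hδ.le
    have hsplit : ∀ t, initMeasure X h₀ ({x ∈ X₁ | s t x ∈ B} ∩ reached X₁ s δ) ≤
        initMeasure X h₀ {x ∈ X₁ | s t x ∈ B ∩ R} +
          initMeasure X h₀ ({x ∈ X₁ | s t x ∈ B \ R} ∩ reached X₁ s δ) := by
      intro t
      refine (measure_mono ?_).trans (measure_union_le _ _)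
      rintro x ⟨⟨hx, hxB⟩, hxδ⟩
      by_cases hxR : s t x ∈ R
      · exact Or.inl ⟨hx, hxB, hxR⟩
      · exact Or.inr ⟨⟨hx, hxB, hxR⟩, hxδ⟩
    have hlate : ∀ t ∈ Ico (j * δ) T,
        initMeasure X h₀ ({x ∈ X₁ | s t x ∈ B \ R} ∩ reached X₁ s δ) = 0 := by
      intro t ht
      have ht0 : 0 ≤ t := le_trans (by positivity) ht.1
      convert measure_empty (μ := initMeasure X h₀)
      rw [eq_empty_iff_forall_notMem]
      rintro x ⟨⟨-, hxB, hxR⟩, -, z, hz, rfl⟩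
      refine hxR ?_
      rw [← h.flow.add h.c1On (h.subset hz) ht0 hδ.le] at hxB ⊢
      exact h.mem_reached_of_le hT (by rw [hTj]; linarith [ht.1]) (h.subset hz) (hBX hxB)
    calc ∫⁻ t in Ioo 0 T, initMeasure X h₀ ({x ∈ X₁ | s t x ∈ B} ∩ reached X₁ s δ)
        ≤ ∫⁻ t in Ioo 0 T, (initMeasure X h₀ {x ∈ X₁ | s t x ∈ B ∩ R} +
          initMeasure X h₀ ({x ∈ X₁ | s t x ∈ B \ R} ∩ reached X₁ s δ)) :=
          lintegral_mono hsplit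
      _ = (∫⁻ t in Ioo 0 T, initMeasure X h₀ {x ∈ X₁ | s t x ∈ B ∩ R}) +
          ∫⁻ t in Ioo 0 T, initMeasure X h₀ ({x ∈ X₁ | s t x ∈ B \ R} ∩ reached X₁ s δ) :=
          lintegral_add_right _ (h.measurable_initMeasure_section (hB.diff hR) hRδ)
      _ ≤ (∫⁻ x in B ∩ R, ENNReal.ofReal (ρ x)) + ∫⁻ x in B \ R, ENNReal.ofReal (ρ x) := by
          refine add_le_add (h.occupation_le_of_subset_reached hρ hρ0 hh₀m hh₀ hdiv
            (hB.inter hR) hT inter_subset_right) ?_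
          refine le_trans ?_ (ih (hB.diff hR) (sdiff_subset.trans hBX))
          have hsub : Ioo 0 T ⊆ Ioo 0 (j * δ) ∪ Ico (j * δ) T := fun t ht => by
            rcases lt_or_ge t (j * δ) with h' | h'
            · exact Or.inl ⟨ht.1, h'⟩
            · exact Or.inr ⟨h', ht.2⟩
          refine (lintegral_mono_set hsub).trans ((lintegral_union_le _ _ _).trans ?_)
          rw [setLIntegral_congr_fun measurableSet_Ico hlate]
          simp
      _ = ∫⁻ x in B, ENNReal.ofReal (ρ x) := lintegral_inter_add_sdiff _ _ hR

/-- If the flux `ρ F` has divergence `h₀` almost everywhere on `X₁`, then `ρ` dominates the density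
of the occupation measure of `X₁`. -/
theorem occupation_le (h : IsTransient F X X₁ s) {ρ h₀ : E n → ℝ}
    (hρ : C1On ρ X₁) (hρ0 : ∀ x ∈ X₁, 0 ≤ ρ x) (hh₀m : Measurable h₀) (hh₀ : ∀ x, 0 ≤ h₀ x)
    (hint : IntegrableOn h₀ X volume)
    (hdiv : ∀ᵐ x ∂(volume.restrict X₁), divergence (fun y => ρ y • F y) x = h₀ x)
    {B : Set (E n)} (hB : MeasurableSet B) (hBX : B ⊆ X₁) :
    ∫⁻ t in Ioi (0 : ℝ), initMeasure X h₀ {x ∈ X₁ | s t x ∈ B} ≤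
      ∫⁻ x in B, ENNReal.ofReal (ρ x) := by
  have := isFiniteMeasure_initMeasure hint
  set δ : ℕ → ℝ := fun m => 1 / (m + 1 : ℝ) with hδ
  have hδpos : ∀ m, 0 < δ m := fun m => Nat.one_div_pos_of_nat
  have hδanti : Antitone δ := fun i j hij =>
    one_div_le_one_div_of_le (by positivity) (by simpa using hij)
  have hRm : ∀ m, MeasurableSet (reached X₁ s (δ m)) := fun m =>
    h.measurableSet_reached (hδpos m).le
  -- the initial states not reached in time `1 / (m + 1)` are negligible as `m` grows
  have hlim : Tendsto (fun m => initMeasure X h₀ (X₁ \ reached X₁ s (δ m))) atTop (𝓝 0) := by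
    have h1 := tendsto_measure_iInter_atTop (μ := initMeasure X h₀)
      (s := fun m => X₁ \ reached X₁ s (δ m))
      (fun m => (h.measurableSet₁.diff (hRm m)).nullMeasurableSet)
      (fun i j hij => sdiff_subset_sdiff_right (h.reached_anti (hδpos j).le (hδanti hij)))
      ⟨0, measure_ne_top _ _⟩
    rw [← sdiff_iUnion] at h1
    rwa [(initMeasure_absolutelyContinuous h₀).trans Measure.absolutelyContinuous_restrict
      h.volume_diff_iUnion_reached] at h1
  have hbound : ∀ k : ℕ, ∫⁻ t in Ioo 0 (k : ℝ), initMeasure X h₀ {x ∈ X₁ | s t x ∈ B} ≤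
      ∫⁻ x in B, ENNReal.ofReal (ρ x) := by
    intro k
    have hm : ∀ m, ∫⁻ t in Ioo 0 (k : ℝ), initMeasure X h₀ {x ∈ X₁ | s t x ∈ B} ≤
        (∫⁻ x in B, ENNReal.ofReal (ρ x)) +
          initMeasure X h₀ (X₁ \ reached X₁ s (δ m)) * volume (Ioo 0 (k : ℝ)) := by
      intro m
      obtain ⟨j, hj⟩ := exists_nat_ge ((k : ℝ) / δ m)
      rw [div_le_iff₀ (hδpos m)] at hj
      calc ∫⁻ t in Ioo 0 (k : ℝ), initMeasure X h₀ {x ∈ X₁ | s t x ∈ B}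
          ≤ ∫⁻ t in Ioo 0 (k : ℝ),
            (initMeasure X h₀ ({x ∈ X₁ | s t x ∈ B} ∩ reached X₁ s (δ m)) +
              initMeasure X h₀ (X₁ \ reached X₁ s (δ m))) := by
            refine lintegral_mono fun t => (measure_mono ?_).trans (measure_union_le _ _)
            intro x hx
            by_cases hxR : x ∈ reached X₁ s (δ m)
            · exact Or.inl ⟨hx, hxR⟩
            · exact Or.inr ⟨hx.1, hxR⟩
        _ = (∫⁻ t in Ioo 0 (k : ℝ),
              initMeasure X h₀ ({x ∈ X₁ | s t x ∈ B} ∩ reached X₁ s (δ m))) +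
            initMeasure X h₀ (X₁ \ reached X₁ s (δ m)) * volume (Ioo 0 (k : ℝ)) := by
            rw [lintegral_add_right _ measurable_const, setLIntegral_const]
        _ ≤ _ := by
            refine add_le_add_left ((lintegral_mono_set (Ioo_subset_Ioo_right hj)).trans
              (h.occupation_inter_reached_le hρ hρ0 hh₀m hh₀ hint hdiv (hδpos m) j hB hBX)) _
    have h2 := (ENNReal.Tendsto.mul_const hlim
      (Or.inr (by simp : volume (Ioo 0 (k : ℝ)) ≠ ⊤))).const_add (∫⁻ x in B, ENNReal.ofReal (ρ x))
    rw [zero_mul, add_zero] at h2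
    exact ge_of_tendsto' h2 hm
  have hU : Ioi (0 : ℝ) = ⋃ k : ℕ, Ioo 0 (k : ℝ) := by
    ext t
    simp only [mem_Ioi, mem_iUnion, mem_Ioo, exists_and_left]
    exact ⟨fun ht => ⟨ht, exists_nat_gt t⟩, fun ht => ht.1⟩
  rw [hU, setLIntegral_iUnion_of_directed _ (directed_of_isDirected_le fun i j hij =>
    Ioo_subset_Ioo_right (Nat.cast_le.2 hij))]
  exact iSup_le hbound

end IsTransient

/-- The occupation measure on `X₁` of the trajectories which start in `X₁` with distribution `μ`. -/
noncomputable def occupationMeasure (X₁ : Set (E n)) (s : ℝ → E n → E n) (μ : Measure (E n)) :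
    Measure (E n) :=
  (((volume.restrict (Ioi (0 : ℝ))).prod (μ.restrict X₁)).map fun q => s q.1 q.2).restrict X₁

namespace IsTransient

lemma occupationMeasure_apply (h : IsTransient F X X₁ s) {μ : Measure (E n)} [SFinite μ]
    {B : Set (E n)} (hB : MeasurableSet B) :
    occupationMeasure X₁ s μ B = ∫⁻ t in Ioi (0 : ℝ), μ {x ∈ X₁ | s t x ∈ B ∩ X₁} := by
  have hB' := hB.inter h.measurableSet₁
  rw [occupationMeasure, Measure.restrict_apply hB, Measure.map_apply h.measurable hB',
    Measure.prod_apply (h.measurable hB')]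
  refine lintegral_congr fun t => ?_
  rw [Measure.restrict_apply (measurable_prodMk_left (h.measurable hB')), inter_comm]
  rfl

lemma lintegral_occupationMeasure (h : IsTransient F X X₁ s) {μ : Measure (E n)} [SFinite μ]
    {φ : E n → ENNReal} (hφ : Measurable φ) :
    ∫⁻ y, φ y ∂(occupationMeasure X₁ s μ) =
      ∫⁻ t in Ioi (0 : ℝ), ∫⁻ x in X₁, X₁.indicator φ (s t x) ∂μ := by
  rw [occupationMeasure, ← lintegral_indicator h.measurableSet₁,
    lintegral_map (hφ.indicator h.measurableSet₁) h.measurable]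
  exact lintegral_prod _ ((hφ.indicator h.measurableSet₁).comp h.measurable).aemeasurable

lemma collision_eq (h : IsTransient F X X₁ s) {μ : Measure (E n)} [SFinite μ] {p : E n → ℝ}
    (hp : Measurable p) :
    collision X₁ s μ p = ∫⁻ y, ENNReal.ofReal (p y) ∂(occupationMeasure X₁ s μ) := by
  rw [h.lintegral_occupationMeasure hp.ennreal_ofReal, collision]
  refine lintegral_congr fun t => lintegral_congr fun x => ?_
  by_cases hx : s t x ∈ X₁ <;> simp [hx]

lemma occupationMeasure_le_of_forall (h : IsTransient F X X₁ s) {μ : Measure (E n)} [SFinite μ]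
    {ρ : E n → ℝ} (hocc : ∀ B : Set (E n), MeasurableSet B → B ⊆ X₁ →
      ∫⁻ t in Ioi (0 : ℝ), μ {x ∈ X₁ | s t x ∈ B} ≤ ∫⁻ x in B, ENNReal.ofReal (ρ x)) :
    occupationMeasure X₁ s μ ≤
      (volume.restrict X₁).withDensity fun x => ENNReal.ofReal (ρ x) := by
  refine Measure.le_iff.2 fun B hB => ?_
  rw [h.occupationMeasure_apply hB, withDensity_apply _ hB, Measure.restrict_restrict hB]
  exact hocc _ (hB.inter h.measurableSet₁) inter_subset_right

lemma occupationMeasure_eq (h : IsTransient F X X₁ s) {μ : Measure (E n)} [SFinite μ]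
    {ρ : E n → ℝ} (hocc : IsOccupationDensity X₁ s μ ρ) :
    occupationMeasure X₁ s μ =
      (volume.restrict X₁).withDensity fun x => ENNReal.ofReal (ρ x) := by
  refine Measure.ext fun B hB => ?_
  rw [h.occupationMeasure_apply hB, withDensity_apply _ hB, Measure.restrict_restrict hB]
  exact hocc _ (hB.inter h.measurableSet₁) inter_subset_right

end IsTransient

/-! ### Consequences of a finite occupation -/

/-- If the total occupation of `X₁` is finite, then almost every trajectory leaves `X₁`. -/
lemma ae_exists_notMem_of_lintegral_ne_top {μ : Measure (E n)}
    (hfin : ∫⁻ t in Ioi (0 : ℝ), μ {x ∈ X₁ | s t x ∈ X₁} ≠ ⊤) :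
    ∀ᵐ x ∂μ, x ∈ X₁ → ∃ t : ℝ, 0 ≤ t ∧ s t x ∉ X₁ := by
  rw [ae_iff]
  by_contra hne
  refine hfin (top_le_iff.1 ?_)
  calc (⊤ : ENNReal) = ∫⁻ _ in Ioi (0 : ℝ), μ {x | ¬(x ∈ X₁ → ∃ t : ℝ, 0 ≤ t ∧ s t x ∉ X₁)} := by
        rw [setLIntegral_const, Real.volume_Ioi, ENNReal.mul_top hne]
    _ ≤ _ := by
        refine setLIntegral_mono' measurableSet_Ioi fun t ht => measure_mono fun x hx => ?_
        simp only [mem_ofPred_eq, Classical.not_imp, not_exists, not_and, not_not] at hx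
        exact ⟨hx.1, hx.2 t (mem_Ioi.1 ht).le⟩

/-- A finite total occupation of `X₁` makes the tails of all occupations uniformly small. -/
lemma aeUniformlyStable_of_lintegral_ne_top {μ : Measure (E n)}
    (hfin : ∫⁻ t in Ioi (0 : ℝ), μ {x ∈ X₁ | s t x ∈ X₁} ≠ ⊤) :
    AEUniformlyStable X₁ s μ := by
  intro ε hε
  set g : ℝ → ENNReal := fun t => μ {x ∈ X₁ | s t x ∈ X₁} with hg
  set ν : Measure ℝ := (volume.restrict (Ioi (0 : ℝ))).withDensity g with hν
  have hνIoi : ∀ k : ℕ, ν (Ioi (k : ℝ)) = ∫⁻ t in Ioi (k : ℝ), g t := fun k => by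
    rw [hν, withDensity_apply _ measurableSet_Ioi, Measure.restrict_restrict measurableSet_Ioi,
      inter_eq_left.2 (Ioi_subset_Ioi (Nat.cast_nonneg k))]
  have hlim := tendsto_measure_iInter_atTop (μ := ν) (s := fun k : ℕ => Ioi (k : ℝ))
    (fun k => measurableSet_Ioi.nullMeasurableSet)
    (fun i j hij => Ioi_subset_Ioi (Nat.cast_le.2 hij))
    ⟨0, by rw [hνIoi]; simpa using hfin⟩
  have hempty : ⋂ k : ℕ, Ioi (k : ℝ) = ∅ := by
    refine eq_empty_iff_forall_notMem.2 fun t ht => ?_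
    obtain ⟨k, hk⟩ := exists_nat_gt t
    exact lt_asymm hk (mem_iInter.1 ht k)
  rw [hempty, measure_empty] at hlim
  obtain ⟨k, hk⟩ := ((tendsto_order.1 hlim).2 ε hε).exists
  refine ⟨k, Nat.cast_nonneg k, fun B _ hBX => ?_⟩
  rw [Function.comp_apply, hνIoi] at hk
  refine lt_of_le_of_lt (lintegral_mono fun t => ?_) hk
  exact measure_mono fun x (hx : x ∈ X₁ ∧ s t x ∈ B) => ⟨hx.1, hBX hx.2⟩

namespace IsTransient

/-- `ρ` is positive along almost every trajectory: almost everywhere on its zero set in `X₁` the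
flux `ρ F` has divergence `0`, so `μ₀` does not charge that set, and `ρ` cannot drop to `0` along a
trajectory. -/
lemma ae_density_pos (h : IsTransient F X X₁ s) {ρ h₀ : E n → ℝ} (hρ : C1On ρ X₁)
    (hρ0 : ∀ x ∈ X₁, 0 ≤ ρ x) (hh₀m : Measurable h₀) (hh₀ : ∀ x, 0 ≤ h₀ x)
    (hdiv : ∀ᵐ x ∂(volume.restrict X₁), divergence (fun y => ρ y • F y) x = h₀ x) :
    ∀ᵐ x ∂(initMeasure X h₀), ∀ t : ℝ, 0 ≤ t → s t x ∈ X₁ → 0 < ρ (s t x) := by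
  set Z := {x ∈ X₁ | ρ x = 0} with hZ
  have hZm : MeasurableSet Z := by
    obtain ⟨U, hU, hXU, hc⟩ := id hρ
    have ho : IsOpen (U ∩ ρ ⁻¹' {0}ᶜ) :=
      hc.continuousOn.isOpen_inter_preimage hU isOpen_compl_singleton
    have : Z = X₁ \ (U ∩ ρ ⁻¹' {0}ᶜ) := by
      ext x
      simp only [hZ, mem_ofPred_eq, Set.mem_sdiff, mem_inter_iff, mem_preimage, mem_compl_iff,
        mem_singleton_iff, not_and, not_not]
      exact ⟨fun hx => ⟨hx.1, fun _ => hx.2⟩, fun hx => ⟨hx.1, hx.2 (hXU hx.1)⟩⟩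
    rw [this]
    exact h.measurableSet₁.diff ho.measurableSet
  have hflux := hρ.smul (h.c1On.mono h.subset)
  have hZdiv := ae_divergence_eq hZm (V := fun y => ρ y • F y) (W := fun _ => 0)
    (fun x hx => hflux.differentiableAt hx.1) (fun x _ => differentiableAt_const _)
    fun x hx => by simp [hx.2]
  rw [ae_restrict_iff' hZm] at hZdiv
  have htr := h.ae_density_transport hρ hρ0 hh₀ hdiv
  rw [ae_restrict_iff' h.measurableSet₁] at hdiv htr
  rw [ae_initMeasure_iff hh₀m, ae_restrict_iff' h.measurableSet]
  filter_upwards [hZdiv, hdiv, htr] with x hxZ hxdiv hxtr hxX hx0 t ht hxt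
  have hx₁ : x ∈ X₁ := by
    have := h.mem_of_le hxX ⟨le_rfl, ht⟩ hxt
    rwa [h.flow.zero hxX] at this
  have hρx : 0 < ρ x := by
    refine (hρ0 x hx₁).lt_of_ne' fun hρx => ?_
    have h1 := hxZ ⟨hx₁, hρx⟩
    rw [hxdiv hx₁] at h1
    simp [divergence, h1] at hx0
  have h2 : 0 < ENNReal.ofReal (ρ (s t x) * flowJacobian F s t x) := by
    rw [hxtr hx₁ t ht hxt]
    exact (ENNReal.ofReal_pos.2 hρx).trans_le le_self_add
  exact pos_of_mul_pos_left (ENNReal.ofReal_pos.1 h2) (flowJacobian_pos t x).le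

end IsTransient

/-! ### Occupation densities solve the transport equation -/

namespace IsTransient

/-- An occupation density transported for a time `T`: what `ρ` gains on a set `A` moved to
`s_T(A)` is the mass of `μ₀` passed on the way. -/
lemma ae_transport_of_isOccupationDensity (h : IsTransient F X X₁ s) {ρ h₀ : E n → ℝ}
    (hρ : C1On ρ X₁) (hh₀m : Measurable h₀) (hocc : IsOccupationDensity X₁ s (initMeasure X h₀) ρ)
    {T : ℝ} (hT : 0 ≤ T) :
    ∀ᵐ x ∂(volume.restrict X₁), s T x ∈ X₁ →
      ENNReal.ofReal (ρ (s T x) * flowJacobian F s T x) = ENNReal.ofReal (ρ x) +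
        ∫⁻ τ in Ioo 0 T, ENNReal.ofReal (flowJacobian F s τ x * h₀ (s τ x)) := by
  set C := X₁ ∩ s T ⁻¹' X₁ with hC
  have hCm : MeasurableSet C := h.measurableSet₁.inter (h.measurable_apply T h.measurableSet₁)
  have hJ : Measurable fun q : ℝ × E n => flowJacobian F s q.1 q.2 :=
    measurable_flowJacobian h.measurable
  have hlayer : Measurable fun x => ∫⁻ τ in Ioo 0 T,
      ENNReal.ofReal (flowJacobian F s τ x * h₀ (s τ x)) :=
    ((hJ.mul (hh₀m.comp h.measurable)).comp measurable_swap).ennreal_ofReal.lintegral_prod_right'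
  have hρC : AEMeasurable (fun x => ENNReal.ofReal (ρ x)) (volume.restrict C) :=
    ((hρ.continuousOn.mono inter_subset_left).aemeasurable hCm).ennreal_ofReal
  have hsC : ContinuousOn (s T) C := fun x hx => by
    obtain ⟨Y, hY, -⟩ := h.flow.exists_hasFDerivWithinAt h.c1On (h.subset hx.1) hT
    exact hY.continuousWithinAt.mono (inter_subset_left.trans h.subset)
  have hρTC : AEMeasurable (fun x => ENNReal.ofReal (ρ (s T x) * flowJacobian F s T x))
      (volume.restrict C) :=
    (((hρ.continuousOn.comp hsC fun x hx => hx.2).aemeasurable hCm).mul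
      (hJ.comp measurable_prodMk_left).aemeasurable).ennreal_ofReal
  have key : ∀ A, MeasurableSet A → A ⊆ C →
      ∫⁻ x in A, ENNReal.ofReal (ρ (s T x) * flowJacobian F s T x) =
        ∫⁻ x in A, (ENNReal.ofReal (ρ x) +
          ∫⁻ τ in Ioo 0 T, ENNReal.ofReal (flowJacobian F s τ x * h₀ (s τ x))) := by
    intro A hAm hAC
    have hA₁ : A ⊆ X₁ := hAC.trans inter_subset_left
    have hAX : A ⊆ X := hA₁.trans h.subset
    have hAT : ∀ x ∈ A, s T x ∈ X₁ := fun x hx => (hAC hx).2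
    have hBm := h.measurableSet_image hT hAm hAX
    have hB₁ : s T '' A ⊆ X₁ := by rintro _ ⟨a, ha, rfl⟩; exact hAT a ha
    have hshift : ∫⁻ t in Ioi T, initMeasure X h₀ {x ∈ X₁ | s t x ∈ s T '' A} =
        ∫⁻ x in A, ENNReal.ofReal (ρ x) := by
      rw [← hocc A hAm hA₁, ← lintegral_indicator measurableSet_Ioi,
        ← lintegral_indicator measurableSet_Ioi, ← lintegral_add_right_eq_self _ T]
      refine lintegral_congr fun t => ?_
      by_cases ht : t ∈ Ioi (0 : ℝ)
      · rw [indicator_of_mem ht, indicator_of_mem (show t + T ∈ Ioi T by simpa using ht)]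
        congr 1
        ext x
        refine and_congr_right fun hx => ?_
        rw [add_comm, h.flow.add h.c1On (h.subset hx) hT (le_of_lt ht)]
        refine ⟨?_, fun hA => ⟨_, hA, rfl⟩⟩
        rintro ⟨a, ha, hax⟩
        rwa [← h.flow.injOn h.c1On hT (hAX ha) (h.flow.mem (h.subset hx) (le_of_lt ht)) hax]
      · rw [indicator_of_notMem ht, indicator_of_notMem (show t + T ∉ Ioi T by simpa using ht)]
    have hsplit : Ioi (0 : ℝ) = Ioc 0 T ∪ Ioi T := (Ioc_union_Ioi_eq_Ioi hT).symm
    have htot := hocc _ hBm hB₁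
    rw [hsplit, lintegral_union measurableSet_Ioi
      (Set.disjoint_left.2 fun t ht ht' => not_lt.2 ht.2 ht'), hshift,
      ← setLIntegral_congr Ioo_ae_eq_Ioc,
      h.lintegral_initMeasure_image hh₀m hAm hA₁ hAT, h.lintegral_image hT hAm hAX] at htot
    rw [lintegral_add_right _ hlayer, add_comm, htot]
    simp_rw [mul_comm (ρ _), ENNReal.ofReal_mul (flowJacobian_pos _ _).le]
  have hae := ae_eq_of_forall_setLIntegral_eq_of_sigmaFinite₀ hρTC
    (hρC.add hlayer.aemeasurable) fun A hA _ => by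
      rw [Measure.restrict_restrict hA]
      exact key _ (hA.inter hCm) inter_subset_right
  rw [EventuallyEq, ae_restrict_iff' hCm] at hae
  rw [ae_restrict_iff' h.measurableSet₁]
  filter_upwards [hae] with x hx hx₁ hxT
  exact hx ⟨hx₁, hxT⟩

end IsTransient

/-- A function on `(0, T)` all of whose integrals over intervals `(0, q)`, `q` rational, vanish is
zero almost everywhere. -/
lemma ae_eq_zero_of_forall_rat_integral_eq_zero {φ : ℝ → ℝ} {T : ℝ} (hT : 0 ≤ T)
    (hφ : IntervalIntegrable φ volume 0 T)
    (h0 : ∀ q : ℚ, 0 < (q : ℝ) → (q : ℝ) < T → ∫ τ in (0 : ℝ)..q, φ τ = 0) :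
    ∀ᵐ τ, τ ∈ Ioo 0 T → φ τ = 0 := by
  have hcont : ContinuousOn (fun u => ∫ τ in (0 : ℝ)..u, φ τ) (Ioo 0 T) :=
    (intervalIntegral.continuousOn_primitive_interval' hφ left_mem_uIcc).mono (by
      rw [uIcc_of_le hT]; exact Ioo_subset_Icc_self)
  have hzero : EqOn (fun u => ∫ τ in (0 : ℝ)..u, φ τ) (fun _ => 0) (Ioo 0 T) := by
    refine Set.EqOn.of_subset_closure (s := Ioo 0 T ∩ range ((↑) : ℚ → ℝ)) ?_ hcont
      continuousOn_const inter_subset_left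
      (Rat.denseRange_cast.open_subset_closure_inter isOpen_Ioo)
    rintro _ ⟨hu, q, rfl⟩
    exact h0 q hu.1 hu.2
  filter_upwards [hφ.ae_hasDerivAt_integral] with τ hτ hτT
  have h1 := hτ (by rw [uIcc_of_le hT]; exact Ioo_subset_Icc_self hτT) 0 left_mem_uIcc
  have h2 : (fun u => ∫ τ in (0 : ℝ)..u, φ τ) =ᶠ[𝓝 τ] fun _ => 0 :=
    mem_of_superset (Ioo_mem_nhds hτT.1 hτT.2) hzero
  exact h1.unique ((hasDerivAt_const τ (0 : ℝ)).congr_of_eventuallyEq h2)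

namespace IsTransient

/-- If `ρ` is an occupation density, the flux `ρ F` has divergence `h₀` along almost every
trajectory. -/
lemma ae_ae_divergence_eq (h : IsTransient F X X₁ s) {ρ h₀ : E n → ℝ}
    (hρ : C1On ρ X₁) (hρ0 : ∀ x ∈ X₁, 0 ≤ ρ x) (hh₀m : Measurable h₀) (hh₀ : ∀ x, 0 ≤ h₀ x)
    (hocc : IsOccupationDensity X₁ s (initMeasure X h₀) ρ) :
    ∀ᵐ x ∂(volume.restrict X₁), ∀ᵐ τ ∂(volume.restrict (Ioi (0 : ℝ))),
      s τ x ∈ X₁ → divergence (fun y => ρ y • F y) (s τ x) = h₀ (s τ x) := by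
  have hall : ∀ᵐ x ∂(volume.restrict X₁), ∀ q : ℚ, 0 ≤ (q : ℝ) → s q x ∈ X₁ →
      ENNReal.ofReal (ρ (s q x) * flowJacobian F s q x) = ENNReal.ofReal (ρ x) +
        ∫⁻ τ in Ioo 0 (q : ℝ), ENNReal.ofReal (flowJacobian F s τ x * h₀ (s τ x)) := by
    rw [ae_all_iff]
    intro q
    by_cases hq : 0 ≤ (q : ℝ)
    · filter_upwards [h.ae_transport_of_isOccupationDensity hρ hh₀m hocc hq] with x hx _ using hx
    · exact Eventually.of_forall fun x hq' => absurd hq' hq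
  filter_upwards [hall, ae_restrict_mem h.measurableSet₁] with x hx hx₁
  have hxX := h.subset hx₁
  set a : ℝ → ℝ := fun τ => flowJacobian F s τ x * h₀ (s τ x) with ha
  set b : ℝ → ℝ := fun τ => flowJacobian F s τ x * divergence (fun y => ρ y • F y) (s τ x) with hb
  have ham : Measurable a := ((measurable_flowJacobian h.measurable).mul
    (hh₀m.comp h.measurable)).comp measurable_prodMk_right
  have ha0 : ∀ τ, 0 ≤ a τ := fun τ => mul_nonneg (flowJacobian_pos τ x).le (hh₀ _)
  have hint : ∀ q : ℚ, 0 < (q : ℝ) → s q x ∈ X₁ →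
      IntervalIntegrable a volume 0 q ∧ IntervalIntegrable b volume 0 q ∧
        ∫ τ in (0 : ℝ)..q, (a τ - b τ) = 0 := by
    intro q hq hxq
    have h1 := hx q hq.le hxq
    have hnn : 0 ≤ ρ (s q x) * flowJacobian F s q x :=
      mul_nonneg (hρ0 _ hxq) (flowJacobian_pos _ _).le
    have hia : IntegrableOn a (Ioo 0 (q : ℝ)) := by
      refine (lintegral_ofReal_ne_top_iff_integrable ham.aestronglyMeasurable
        (Eventually.of_forall ha0)).1 (ne_top_of_le_ne_top ENNReal.ofReal_ne_top
        (b := ENNReal.ofReal (ρ (s q x) * flowJacobian F s q x)) ?_)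
      rw [h1]
      exact le_add_self
    have hIa : IntervalIntegrable a volume 0 q :=
      (intervalIntegrable_iff_integrableOn_Ioo_of_le hq.le).2 hia
    have hIb : IntervalIntegrable b volume 0 q := ContinuousOn.intervalIntegrable (by
      rw [uIcc_of_le hq.le]; exact h.continuousOn_flux hρ hxX hxq)
    refine ⟨hIa, hIb, ?_⟩
    have hia0 : 0 ≤ ∫ τ in Ioo 0 (q : ℝ), a τ := integral_nonneg ha0
    rw [← ofReal_integral_eq_lintegral_ofReal hia (Eventually.of_forall ha0),
      ← ENNReal.ofReal_add (hρ0 x hx₁) hia0,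
      ENNReal.ofReal_eq_ofReal_iff hnn (add_nonneg (hρ0 x hx₁) hia0),
      h.density_transport hρ hxX hq.le hxq] at h1
    rw [intervalIntegral.integral_sub hIa hIb, intervalIntegral.integral_of_le (f := a) hq.le,
      integral_Ioc_eq_integral_Ioo]
    linarith
  have hae : ∀ᵐ τ, ∀ q : ℚ, 0 < (q : ℝ) → s q x ∈ X₁ → τ ∈ Ioo 0 (q : ℝ) → a τ = b τ := by
    rw [ae_all_iff]
    intro q
    by_cases hq : 0 < (q : ℝ) ∧ s q x ∈ X₁
    · obtain ⟨hIa, hIb, -⟩ := hint q hq.1 hq.2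
      filter_upwards [ae_eq_zero_of_forall_rat_integral_eq_zero hq.1.le (hIa.sub hIb)
        fun r hr hrq => (hint r hr (h.mem_of_le hxX ⟨hr.le, hrq.le⟩ hq.2)).2.2] with τ hτ _ _ hτq
      exact sub_eq_zero.1 (hτ hτq)
    · exact Eventually.of_forall fun τ h1 h2 => absurd ⟨h1, h2⟩ hq
  -- only the exit time itself, if it is attained in `X₁`, has no later rational time in `X₁`
  have hlast : {τ : ℝ | 0 ≤ τ ∧ s τ x ∈ X₁ ∧ ∀ q : ℚ, τ < q → s q x ∉ X₁}.Subsingleton := by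
    intro t₁ h₁ t₂ h₂
    by_contra hne
    wlog hlt : t₁ < t₂ generalizing t₁ t₂
    · exact this h₂ h₁ (Ne.symm hne) (lt_of_le_of_ne (not_lt.1 hlt) (Ne.symm hne))
    obtain ⟨q, hq1, hq2⟩ := exists_rat_btwn hlt
    exact h₁.2.2 q hq1 (h.mem_of_le hxX ⟨h₁.1.trans hq1.le, hq2.le⟩ h₂.2.1)
  have hlast' : ∀ᵐ τ : ℝ, ¬(0 ≤ τ ∧ s τ x ∈ X₁ ∧ ∀ q : ℚ, τ < q → s q x ∉ X₁) := by
    rw [ae_iff]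
    simpa only [not_not] using hlast.measure_zero volume
  rw [ae_restrict_iff' measurableSet_Ioi]
  filter_upwards [hae, hlast'] with τ hτ hτl hτ0 hxτ
  have : ∃ q : ℚ, τ < q ∧ s q x ∈ X₁ := by
    by_contra! hno
    exact hτl ⟨le_of_lt hτ0, hxτ, hno⟩
  obtain ⟨q, hτq, hxq⟩ := this
  have h1 := hτ q ((mem_Ioi.1 hτ0).trans hτq) hxq ⟨hτ0, hτq⟩
  exact (mul_left_cancel₀ (flowJacobian_pos τ x).ne' h1).symm

/-- A `C¹` occupation density solves the transport equation `∇·(ρ F) = h₀`. -/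
theorem ae_divergence_eq_of_isOccupationDensity (h : IsTransient F X X₁ s) {ρ h₀ : E n → ℝ}
    (hρ : C1On ρ X₁) (hρ0 : ∀ x ∈ X₁, 0 ≤ ρ x) (hh₀m : Measurable h₀) (hh₀ : ∀ x, 0 ≤ h₀ x)
    (hocc : IsOccupationDensity X₁ s (initMeasure X h₀) ρ) :
    ∀ᵐ x ∂(volume.restrict X₁), divergence (fun y => ρ y • F y) x = h₀ x := by
  set Q := {y ∈ X₁ | divergence (fun y => ρ y • F y) y ≠ h₀ y} with hQ
  have hQm : MeasurableSet Q :=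
    h.measurableSet₁.inter (measurableSet_eq_fun measurable_divergence hh₀m).compl
  have hswap : ∀ᵐ τ ∂(volume.restrict (Ioi (0 : ℝ))), ∀ᵐ x ∂(volume.restrict X₁), s τ x ∉ Q := by
    have h1 : ∀ᵐ x ∂(volume.restrict X₁), ∀ᵐ τ ∂(volume.restrict (Ioi (0 : ℝ))), s τ x ∉ Q := by
      filter_upwards [h.ae_ae_divergence_eq hρ hρ0 hh₀m hh₀ hocc] with x hx
      filter_upwards [hx] with τ hτ hτQ using hτQ.2 (hτ hτQ.1)
    rwa [Measure.ae_ae_comm ((h.measurable.comp measurable_swap) hQm).compl] at h1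
  have hnull : ∀ m : ℕ, volume (Q ∩ reached X₁ s (1 / (m + 1 : ℝ))) = 0 := by
    intro m
    have hm : (0 : ℝ) < 1 / (m + 1 : ℝ) := Nat.one_div_pos_of_nat
    obtain ⟨τ, hτ, hτm⟩ : ∃ τ ∈ Ioo (0 : ℝ) (1 / (m + 1 : ℝ)),
        ∀ᵐ x ∂(volume.restrict X₁), s τ x ∉ Q := by
      have h1 := ae_restrict_of_ae_restrict_of_subset
        (fun t (ht : t ∈ Ioo (0 : ℝ) (1 / (m + 1 : ℝ))) => mem_Ioi.2 ht.1) hswap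
      have : NeBot (ae (volume.restrict (Ioo (0 : ℝ) (1 / (m + 1 : ℝ))))) := by
        rw [ae_neBot, ne_eq, Measure.restrict_eq_zero, Real.volume_Ioo]
        simpa using hm
      obtain ⟨τ, h2, h3⟩ := (h1.and (ae_restrict_mem measurableSet_Ioo)).exists
      exact ⟨τ, h3, h2⟩
    set A := X₁ ∩ s τ ⁻¹' Q with hA
    have hAm : MeasurableSet A := h.measurableSet₁.inter (h.measurable_apply τ hQm)
    have hA0 : volume A = 0 := by
      rw [ae_restrict_iff' h.measurableSet₁, ae_iff] at hτm
      convert hτm using 2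
      ext x
      simp [hA]
    have himg : volume (s τ '' A) = 0 := by
      rw [← setLIntegral_one, h.lintegral_image hτ.1.le hAm (inter_subset_left.trans h.subset),
        Measure.restrict_eq_zero.2 hA0, lintegral_zero_measure]
    refine measure_mono_null ?_ himg
    rintro y ⟨hyQ, hy⟩
    obtain ⟨-, z, hz, rfl⟩ := h.reached_anti hτ.1.le hτ.2.le hy
    exact ⟨z, ⟨hz, hyQ⟩, rfl⟩
  rw [ae_restrict_iff' h.measurableSet₁, ae_iff]
  refine measure_mono_null (t := (X₁ \ ⋃ m : ℕ, reached X₁ s (1 / (m + 1 : ℝ))) ∪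
    ⋃ m : ℕ, Q ∩ reached X₁ s (1 / (m + 1 : ℝ))) (fun y hy => ?_)
    (measure_union_null h.volume_diff_iUnion_reached (measure_iUnion_null hnull))
  have hyQ : y ∈ Q := by simpa [hQ] using hy
  by_cases hyr : y ∈ ⋃ m : ℕ, reached X₁ s (1 / (m + 1 : ℝ))
  · obtain ⟨m, hm⟩ := mem_iUnion.1 hyr
    exact Or.inr (mem_iUnion.2 ⟨m, hyQ, hm⟩)
  · exact Or.inl ⟨hyQ.1, hyr⟩

end IsTransient

/-! ### Choice of a Borel flow -/

/-- The values of a solution flow at negative times and outside the state space can be chosen so as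
to make it Borel. -/
lemma IsSolutionFlow.exists_measurable (hs : IsSolutionFlow F X s) (hF : C1On F X)
    (hX : MeasurableSet X) : ∃ S : ℝ → E n → E n, Measurable (fun q : ℝ × E n => S q.1 q.2) ∧
      IsSolutionFlow F X S ∧ ∀ t, 0 ≤ t → ∀ x ∈ X, S t x = s t x := by
  classical
  set D : Set (ℝ × E n) := Ici 0 ×ˢ X with hD
  have heq : ∀ t, 0 ≤ t → ∀ x ∈ X, D.piecewise (fun q => s q.1 q.2) (fun _ => 0) (t, x) = s t x :=
    fun t ht x hx => piecewise_eq_of_mem _ _ _ ⟨ht, hx⟩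
  refine ⟨fun t x => D.piecewise (fun q => s q.1 q.2) (fun _ => 0) (t, x), ?_, ?_, heq⟩
  · exact (hs.continuousOn_uncurry hF).measurable_piecewise continuousOn_const
      (measurableSet_Ici.prod hX)
  · intro x hx
    refine ⟨(heq 0 le_rfl x hx).trans (hs.zero hx), fun t ht => ?_⟩
    beta_reduce
    rw [heq t ht x hx]
    exact ⟨hs.mem hx ht, (hs.hasDerivWithinAt hx ht).congr (fun τ hτ => heq τ hτ x hx)
      (heq t ht x hx)⟩

lemma setOf_mem_congr (hX₁ : X₁ ⊆ X) (hSs : ∀ t, 0 ≤ t → ∀ x ∈ X, S t x = s t x) {t : ℝ}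
    (ht : 0 ≤ t) (B : Set (E n)) : {x ∈ X₁ | S t x ∈ B} = {x ∈ X₁ | s t x ∈ B} := by
  ext x
  exact and_congr_right fun hx => by rw [hSs t ht x (hX₁ hx)]

lemma IsOccupationDensity.congr {μ : Measure (E n)} (h : IsOccupationDensity X₁ s μ ρ)
    (hX₁ : X₁ ⊆ X) (hSs : ∀ t, 0 ≤ t → ∀ x ∈ X, S t x = s t x) :
    IsOccupationDensity X₁ S μ ρ := fun B hB hBX => by
  rw [← h B hB hBX]
  exact setLIntegral_congr_fun measurableSet_Ioi fun t ht => by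
    simp only [setOf_mem_congr hX₁ hSs (mem_Ioi.1 ht).le B]

lemma AEUniformlyStable.congr {μ : Measure (E n)} (h : AEUniformlyStable X₁ s μ)
    (hX₁ : X₁ ⊆ X) (hSs : ∀ t, 0 ≤ t → ∀ x ∈ X, S t x = s t x) :
    AEUniformlyStable X₁ S μ := fun ε hε => by
  obtain ⟨T, hT, h1⟩ := h ε hε
  refine ⟨T, hT, fun B hB hBX => lt_of_eq_of_lt ?_ (h1 B hB hBX)⟩
  exact setLIntegral_congr_fun measurableSet_Ioi fun t ht => by
    simp only [setOf_mem_congr hX₁ hSs (hT.trans (mem_Ioi.1 ht).le) B]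

lemma collision_congr {μ : Measure (E n)} (hm : MeasurableSet X₁)
    (hX₁ : X₁ ⊆ X) (hSs : ∀ t, 0 ≤ t → ∀ x ∈ X, S t x = s t x) :
    collision X₁ S μ p = collision X₁ s μ p :=
  setLIntegral_congr_fun measurableSet_Ioi fun t ht =>
    setLIntegral_congr_fun hm fun x hx => by
      simp only [hSs t (mem_Ioi.1 ht).le x (hX₁ hx)]

/-- The complement of a positively invariant set is never re-entered. -/
lemma IsSolutionFlow.isTransient (hs : IsSolutionFlow F X s) (hF : C1On F X) (hX : MeasurableSet X)
    (hN : MeasurableSet N) (hm : Measurable fun q : ℝ × E n => s q.1 q.2)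
    (hinv : ∀ x ∈ X ∩ N, ∀ t : ℝ, 0 ≤ t → s t x ∈ N) : IsTransient F X (X \ N) s where
  flow := hs
  c1On := hF
  measurableSet := hX
  measurable := hm
  measurableSet₁ := hX.diff hN
  subset := sdiff_subset
  not_reenter x hx a b ha hab hb := by
    refine ⟨hs.mem hx ha, fun haN => hb.2 ?_⟩
    have := hinv (s a x) ⟨hs.mem hx ha, haN⟩ (b - a) (sub_nonneg.2 hab)
    rwa [← hs.add hF hx (sub_nonneg.2 hab) ha, sub_add_cancel] at this

lemma LocallyStable.congr (h : LocallyStable F X N s)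
    (hSs : ∀ t, 0 ≤ t → ∀ x ∈ X, S t x = s t x) : LocallyStable F X N S where
  zero_mem := h.zero_mem
  equilibrium := h.equilibrium
  stable ε hε := by
    obtain ⟨η, hη, h1⟩ := h.stable ε hε
    exact ⟨η, hη, fun x hx hxη t ht => by rw [hSs t ht x hx]; exact h1 x hx hxη t ht⟩
  nhds := h.nhds
  invariant x hx t ht := by rw [hSs t ht x hx.1]; exact h.invariant x hx t ht
  attracted x hx := (h.attracted x hx).congr' (by
    filter_upwards [eventually_ge_atTop 0] with t ht using (hSs t ht x hx.1).symm)

/-! ### Convexity of the feasibility problem -/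

lemma Feasible.linear_comb (hX₁ : MeasurableSet X₁) (hf : C1On f X₁) (hg : C1On g X₁)
    (hp : Measurable p) (hp0 : ∀ x, 0 ≤ p x) {ρ₁ ρ₁' ρ₂ ρ₂' : E n → ℝ}
    (h₁ : Feasible f g X₁ h₀ p γ M ρ₁ ρ₁') (h₂ : Feasible f g X₁ h₀ p γ M ρ₂ ρ₂') {a b : ℝ}
    (ha : 0 ≤ a) (hb : 0 ≤ b) (hab : a + b = 1) :
    Feasible f g X₁ h₀ p γ M (fun x => a * ρ₁ x + b * ρ₂ x) (fun x => a * ρ₁' x + b * ρ₂' x) where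
  smooth := (h₁.smooth.const_smul a).add (h₂.smooth.const_smul b)
  smooth' := (h₁.smooth'.const_smul a).add (h₂.smooth'.const_smul b)
  nonneg x hx := add_nonneg (mul_nonneg ha (h₁.nonneg x hx)) (mul_nonneg hb (h₂.nonneg x hx))
  integrable := (h₁.integrable.const_mul a).add (h₂.integrable.const_mul b)
  div_eq := by
    filter_upwards [h₁.div_eq, h₂.div_eq, ae_restrict_mem hX₁] with x hx₁ hx₂ hx
    have e : (fun y => (a * ρ₁ y + b * ρ₂ y) • f y + (a * ρ₁' y + b * ρ₂' y) • g y) =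
        fun y => a • (ρ₁ y • f y + ρ₁' y • g y) + b • (ρ₂ y • f y + ρ₂' y • g y) := by
      ext1 y; module
    rw [e, divergence_linear_comb
      (((h₁.smooth.smul hf).add (h₁.smooth'.smul hg)).differentiableAt hx)
      (((h₂.smooth.smul hf).add (h₂.smooth'.smul hg)).differentiableAt hx), hx₁, hx₂, ← add_mul,
      hab, one_mul]
  safe := by
    have e : ∀ x ∈ X₁, ENNReal.ofReal (p x * (a * ρ₁ x + b * ρ₂ x)) =
        ENNReal.ofReal a * ENNReal.ofReal (p x * ρ₁ x) +
          ENNReal.ofReal b * ENNReal.ofReal (p x * ρ₂ x) := fun x hx => by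
      have hp₁ := mul_nonneg (hp0 x) (h₁.nonneg x hx)
      have hp₂ := mul_nonneg (hp0 x) (h₂.nonneg x hx)
      rw [← ENNReal.ofReal_mul ha, ← ENNReal.ofReal_mul hb,
        ← ENNReal.ofReal_add (mul_nonneg ha hp₁) (mul_nonneg hb hp₂)]
      congr 1; ring
    rw [setLIntegral_congr_fun hX₁ e, lintegral_add_left'
      ((hp.aemeasurable.fun_mul (h₁.smooth.continuousOn.aemeasurable hX₁)).ennreal_ofReal.const_mul _),
      lintegral_const_mul' _ _ ENNReal.ofReal_ne_top,
      lintegral_const_mul' _ _ ENNReal.ofReal_ne_top]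
    calc _ ≤ ENNReal.ofReal a * ENNReal.ofReal γ + ENNReal.ofReal b * ENNReal.ofReal γ := by
          gcongr
          · exact h₁.safe
          · exact h₂.safe
      _ = ENNReal.ofReal γ := by
          rw [← add_mul, ← ENNReal.ofReal_add ha hb, hab, ENNReal.ofReal_one, one_mul]
  bound x hx := by
    calc |a * ρ₁' x + b * ρ₂' x| ≤ |a * ρ₁' x| + |b * ρ₂' x| := abs_add_le _ _
      _ = a * |ρ₁' x| + b * |ρ₂' x| := by rw [abs_mul, abs_mul, abs_of_nonneg ha, abs_of_nonneg hb]
      _ ≤ a * (M * ρ₁ x) + b * (M * ρ₂ x) :=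
          add_le_add (mul_le_mul_of_nonneg_left (h₁.bound x hx) ha)
            (mul_le_mul_of_nonneg_left (h₂.bound x hx) hb)
      _ = M * (a * ρ₁ x + b * ρ₂ x) := by ring

/-! ### Feasible pairs and solutions of the navigation problem -/

/-- A trajectory that enters the local domain of attraction converges to the origin. -/
lemma LocallyStable.tendsto_of_mem (h : LocallyStable F X N s) (hs : IsSolutionFlow F X s)
    (hF : C1On F X) {x : E n} (hx : x ∈ X) {t : ℝ} (ht : 0 ≤ t) (hxt : s t x ∈ N) :
    Tendsto (fun τ => s τ x) atTop (𝓝 0) := by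
  have h1 := (h.attracted (s t x) ⟨hs.mem hx ht, hxt⟩).comp
    (tendsto_atTop_add_const_right atTop (-t) tendsto_id)
  refine h1.congr' ?_
  filter_upwards [eventually_ge_atTop t] with τ hτ
  have hτ' : 0 ≤ τ + -t := by linarith
  simp only [Function.comp_apply, id]
  rw [← hs.add hF hx hτ' ht]
  congr 1; ring

/-- The solution of the transport equation extracted from a feasible pair whose quotient is the
feedback `k`. -/
lemma Feasible.ae_divergence_closedLoop (h : Feasible f g X₁ h₀ p γ M ρ ρ')
    (hX₁ : MeasurableSet X₁) (hf : C1On f X₁) (hg : C1On g X₁) (hk : C1On k X₁)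
    (hkρ : ∀ x ∈ X₁, ρ x ≠ 0 → k x = ρ' x / ρ x) :
    ∀ᵐ x ∂(volume.restrict X₁),
      divergence (fun y => ρ y • SafeNav.closedLoop f g k y) x = h₀ x := by
  have hρ' : ∀ x ∈ X₁, ρ' x = k x * ρ x := by
    intro x hx
    by_cases hρ : ρ x = 0
    · -- the input bound forces `ρ'` to vanish wherever `ρ` does
      simpa [hρ] using h.bound x hx
    · rw [hkρ x hx hρ, div_mul_cancel₀ _ hρ]
  have he := ae_divergence_eq hX₁ (V := fun y => ρ y • SafeNav.closedLoop f g k y)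
    (W := fun y => ρ y • f y + ρ' y • g y)
    (fun x hx => (h.smooth.smul (hf.closedLoop hg hk)).differentiableAt hx)
    (fun x hx => ((h.smooth.smul hf).add (h.smooth'.smul hg)).differentiableAt hx)
    fun x hx => by simp only [SafeNav.closedLoop, hρ' x hx]; module
  filter_upwards [he, h.div_eq] with x hx hx' using hx.trans hx'

lemma Feasible.abs_le_of_eq_div (h : Feasible f g X₁ h₀ p γ M ρ ρ')
    (hkρ : ∀ x ∈ X₁, ρ x ≠ 0 → k x = ρ' x / ρ x) {x : E n} (hx : x ∈ X₁) (hρ : ρ x ≠ 0) :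
    |k x| ≤ M := by
  have hpos : 0 < ρ x := (h.nonneg x hx).lt_of_ne' hρ
  rw [hkρ x hx hρ, abs_div, abs_of_pos hpos, div_le_iff₀ hpos]
  exact h.bound x hx

/-- Duality between the occupation measure and the density: a feasible density controls the
occupation of `X \ N`, hence all the requirements of the navigation problem. -/
theorem Feasible.solvesNavigation (h : Feasible f g (X \ N) h₀ p γ M ρ ρ')
    (hX : MeasurableSet X) (hN : MeasurableSet N) (hf : C1On f X) (hg : C1On g X) (hk : C1On k X)
    (hh₀ : Measurable h₀) (hh₀_nonneg : ∀ x, 0 ≤ h₀ x) (hh₀_int : IntegrableOn h₀ X volume)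
    (hX₀ : X₀ ⊆ X) (hX₀_supp : ∀ᵐ x ∂(volume.restrict X), x ∈ X₀ ↔ 0 < h₀ x)
    (hp : Measurable p) (hp_nonneg : ∀ x, 0 ≤ p x)
    (hs : IsSolutionFlow (SafeNav.closedLoop f g k) X s)
    (hst : LocallyStable (SafeNav.closedLoop f g k) X N s)
    (hkρ : ∀ x ∈ X \ N, ρ x ≠ 0 → k x = ρ' x / ρ x) :
    SolvesNavigation X N X₀ h₀ p γ M k s ∧
      ∀ᵐ x ∂(initMeasure X h₀), ∀ t : ℝ, 0 ≤ t → s t x ∈ X \ N →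
        0 < ρ (s t x) ∧ k (s t x) = ρ' (s t x) / ρ (s t x) := by
  have hF := hf.closedLoop hg hk
  have hX₁ : X \ N ⊆ X := sdiff_subset
  have hX₁m : MeasurableSet (X \ N) := hX.diff hN
  have hfin := isFiniteMeasure_initMeasure hh₀_int
  obtain ⟨S, hSm, hS, hSs⟩ := hs.exists_measurable hF hX
  have hSs' : ∀ t, 0 ≤ t → ∀ x ∈ X, s t x = S t x := fun t ht x hx => (hSs t ht x hx).symm
  have hSst := hst.congr hSs
  have hT : IsTransient (SafeNav.closedLoop f g k) X (X \ N) S :=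
    hS.isTransient hF hX hN hSm hSst.invariant
  have hdiv := h.ae_divergence_closedLoop hX₁m (hf.mono hX₁) (hg.mono hX₁) (hk.mono hX₁) hkρ
  have hocc := fun B hB hBX => hT.occupation_le h.smooth h.nonneg hh₀ hh₀_nonneg hh₀_int hdiv
    (B := B) hB hBX
  have htot : ∫⁻ t in Ioi (0 : ℝ), initMeasure X h₀ {x ∈ X \ N | S t x ∈ X \ N} ≠ ⊤ := by
    refine ne_top_of_le_ne_top ?_ (hocc _ hX₁m Subset.rfl)
    exact ((lintegral_mono fun x => Real.ofReal_le_enorm (ρ x)).trans_lt h.integrable.2).ne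
  have hμX : ∀ᵐ x ∂(initMeasure X h₀), x ∈ X :=
    initMeasure_absolutelyContinuous h₀ (ae_restrict_mem hX)
  have hpos : ∀ᵐ x ∂(initMeasure X h₀), ∀ t : ℝ, 0 ≤ t → s t x ∈ X \ N →
      0 < ρ (s t x) ∧ k (s t x) = ρ' (s t x) / ρ (s t x) := by
    filter_upwards [hT.ae_density_pos h.smooth h.nonneg hh₀ hh₀_nonneg hdiv, hμX]
      with x hx hxX t ht hxt
    rw [hSs' t ht x hxX] at hxt ⊢
    exact ⟨hx t ht hxt, hkρ _ hxt (hx t ht hxt).ne'⟩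
  refine ⟨⟨?_, ?_, ?_, ?_⟩, hpos⟩
  · have h1 := ae_exists_notMem_of_lintegral_ne_top htot
    rw [ae_initMeasure_iff hh₀, ae_restrict_iff' hX] at h1
    rw [ae_restrict_iff' hX] at hX₀_supp
    filter_upwards [h1, hX₀_supp] with x hx hx₀ hxX₀
    have hxX := hX₀ hxX₀
    by_cases hxN : x ∈ N
    · exact hst.attracted x ⟨hxX, hxN⟩
    · obtain ⟨t, ht, hxt⟩ := hx hxX ((hx₀ hxX).1 hxX₀) ⟨hxX, hxN⟩
      rw [hSs t ht x hxX] at hxt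
      refine hst.tendsto_of_mem hs hF hxX ht ?_
      by_contra hnot
      exact hxt ⟨hs.mem hxX ht, hnot⟩
  · exact (aeUniformlyStable_of_lintegral_ne_top htot).congr hX₁ hSs'
  · rw [collision_congr hX₁m hX₁ hSs', hT.collision_eq hp]
    refine le_trans ?_ h.safe
    refine (lintegral_mono' (hT.occupationMeasure_le_of_forall hocc) le_rfl).trans (le_of_eq ?_)
    rw [lintegral_withDensity_eq_lintegral_mul₀
      (h.smooth.continuousOn.aemeasurable hX₁m).ennreal_ofReal hp.ennreal_ofReal.aemeasurable]
    refine lintegral_congr fun x => ?_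
    rw [Pi.mul_apply, mul_comm, ENNReal.ofReal_mul (hp_nonneg x)]
  · filter_upwards [hpos] with x hx t ht hxt
    exact h.abs_le_of_eq_div hkρ hxt (hx t ht hxt).1.ne'

/-- A `C¹` density of the occupation measure of a solution of the navigation problem is
feasible. -/
theorem SolvesNavigation.feasible (h : SolvesNavigation X N X₀ h₀ p γ M k s)
    (hX : MeasurableSet X) (hN : MeasurableSet N) (hf : C1On f X) (hg : C1On g X) (hk : C1On k X)
    (hh₀ : Measurable h₀) (hh₀_nonneg : ∀ x, 0 ≤ h₀ x) (hh₀_int : IntegrableOn h₀ X volume)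
    (hp : Measurable p) (hp_nonneg : ∀ x, 0 ≤ p x)
    (hs : IsSolutionFlow (SafeNav.closedLoop f g k) X s)
    (hst : LocallyStable (SafeNav.closedLoop f g k) X N s)
    (hkM : ∀ x ∈ X \ N, |k x| ≤ M) (hρ : C1On ρ (X \ N)) (hρ0 : ∀ x ∈ X \ N, 0 ≤ ρ x)
    (hocc : IsOccupationDensity (X \ N) s (initMeasure X h₀) ρ) :
    Feasible f g (X \ N) h₀ p γ M ρ (fun x => k x * ρ x) := by
  have hF := hf.closedLoop hg hk
  have hX₁ : X \ N ⊆ X := sdiff_subset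
  have hX₁m : MeasurableSet (X \ N) := hX.diff hN
  have hfin := isFiniteMeasure_initMeasure hh₀_int
  obtain ⟨S, hSm, hS, hSs⟩ := hs.exists_measurable hF hX
  have hT : IsTransient (SafeNav.closedLoop f g k) X (X \ N) S :=
    hS.isTransient hF hX hN hSm (hst.congr hSs).invariant
  have hoccS := hocc.congr hX₁ hSs
  refine ⟨hρ, hρ0, ?_, (hk.mono hX₁).smul hρ, ?_, ?_, fun x hx => ?_⟩
  · -- after a time `T` the occupation is at most `1`, and before `T` at most `T μ₀(X)`
    refine ⟨hρ.continuousOn.aestronglyMeasurable hX₁m, ?_⟩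
    rw [hasFiniteIntegral_iff_ofReal (by
      filter_upwards [ae_restrict_mem hX₁m] with x hx using hρ0 x hx), ← hocc _ hX₁m Subset.rfl]
    obtain ⟨T, hT0, hTlt⟩ := h.uniformlyStable 1 one_pos
    rw [← Ioc_union_Ioi_eq_Ioi hT0]
    refine (lintegral_union_le _ _ _).trans_lt (ENNReal.add_lt_top.2 ⟨?_, ?_⟩)
    · refine (lintegral_mono fun t => measure_mono (subset_univ _)).trans_lt ?_
      rw [setLIntegral_const, Real.volume_Ioc]
      exact ENNReal.mul_lt_top (measure_lt_top _ _) ENNReal.ofReal_lt_top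
    · exact (hTlt _ hX₁m Subset.rfl).trans ENNReal.one_lt_top
  · have e : (fun y => ρ y • f y + (k y * ρ y) • g y) =
        fun y => ρ y • SafeNav.closedLoop f g k y := by
      ext1 y; simp only [SafeNav.closedLoop]; module
    rw [e]
    exact hT.ae_divergence_eq_of_isOccupationDensity hρ hρ0 hh₀ hh₀_nonneg hoccS
  · refine le_trans (le_of_eq ?_) h.safe
    rw [← collision_congr hX₁m hX₁ hSs, hT.collision_eq hp, hT.occupationMeasure_eq hoccS,
      lintegral_withDensity_eq_lintegral_mul₀
        (hρ.continuousOn.aemeasurable hX₁m).ennreal_ofReal hp.ennreal_ofReal.aemeasurable]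
    refine lintegral_congr fun x => ?_
    rw [Pi.mul_apply, mul_comm (ENNReal.ofReal (ρ x)), ENNReal.ofReal_mul (hp_nonneg x)]
  · rw [abs_mul, abs_of_nonneg (hρ0 x hx)]
    exact mul_le_mul_of_nonneg_right (hkM x hx) (hρ0 x hx)

end SafeNav

theorem theorem3 {n : ℕ} (f g : SafeNav.E n → SafeNav.E n) (X N X₀ : Set (SafeNav.E n))
    (h₀ p : SafeNav.E n → ℝ) (γ M : ℝ)
    (hX : MeasurableSet X) (hN : MeasurableSet N)
    (hf : SafeNav.C1On f X) (hg : SafeNav.C1On g X)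
    (hh₀ : Measurable h₀) (hh₀_nonneg : ∀ x, 0 ≤ h₀ x) (hh₀_int : IntegrableOn h₀ X volume)
    (hX₀ : X₀ ⊆ X) (hX₀_supp : ∀ᵐ x ∂(volume.restrict X), x ∈ X₀ ↔ 0 < h₀ x)
    (hp : Measurable p) (hp_nonneg : ∀ x, 0 ≤ p x) (hγ : 0 ≤ γ) :
    -- the feasibility problem is convex
    Convex ℝ {q : (SafeNav.E n → ℝ) × (SafeNav.E n → ℝ) |
      SafeNav.Feasible f g (X \ N) h₀ p γ M q.1 q.2} ∧
    -- a feasible pair yields a controller that solves the synthesis problem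
    (∀ ρ ρ' : SafeNav.E n → ℝ, SafeNav.Feasible f g (X \ N) h₀ p γ M ρ ρ' →
      ∀ (k : SafeNav.E n → ℝ) (s : ℝ → SafeNav.E n → SafeNav.E n),
        SafeNav.C1On k X →
        SafeNav.IsSolutionFlow (SafeNav.closedLoop f g k) X s →
        SafeNav.LocallyStable (SafeNav.closedLoop f g k) X N s →
        (∀ x ∈ X \ N, ρ x ≠ 0 → k x = ρ' x / ρ x) →
          SafeNav.SolvesNavigation X N X₀ h₀ p γ M k s ∧
          (∀ x ∈ X \ N, ρ x ≠ 0 → |k x| ≤ M) ∧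
          (∀ᵐ x ∂(SafeNav.initMeasure X h₀), ∀ t : ℝ, 0 ≤ t → s t x ∈ X \ N →
            0 < ρ (s t x) ∧ k (s t x) = ρ' (s t x) / ρ (s t x))) ∧
    -- a controller that solves the synthesis problem yields a feasible pair
    (∀ (k : SafeNav.E n → ℝ) (s : ℝ → SafeNav.E n → SafeNav.E n),
        SafeNav.C1On k X →
        SafeNav.IsSolutionFlow (SafeNav.closedLoop f g k) X s →
        SafeNav.LocallyStable (SafeNav.closedLoop f g k) X N s →
        SafeNav.SolvesNavigation X N X₀ h₀ p γ M k s →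
        (∀ x ∈ X \ N, |k x| ≤ M) →
        ∀ ρ : SafeNav.E n → ℝ, SafeNav.C1On ρ (X \ N) → (∀ x ∈ X \ N, 0 ≤ ρ x) →
          SafeNav.IsOccupationDensity (X \ N) s (SafeNav.initMeasure X h₀) ρ →
          SafeNav.Feasible f g (X \ N) h₀ p γ M ρ (fun x => k x * ρ x)) := by
  have hX₁ : X \ N ⊆ X := sdiff_subset
  refine ⟨fun q₁ h₁ q₂ h₂ a b ha hb hab => ?_, fun ρ ρ' h k s hk hs hst hkρ => ?_,
    fun k s hk hs hst hsol hkM ρ hρ hρ0 hocc => ?_⟩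
  · exact SafeNav.Feasible.linear_comb (hX.diff hN) (hf.mono hX₁) (hg.mono hX₁) hp hp_nonneg
      h₁ h₂ ha hb hab
  · obtain ⟨hsol, hpos⟩ := h.solvesNavigation hX hN hf hg hk hh₀ hh₀_nonneg hh₀_int hX₀ hX₀_supp
      hp hp_nonneg hs hst hkρ
    exact ⟨hsol, fun x hx hρ => h.abs_le_of_eq_div hkρ hx hρ, hpos⟩
  · exact hsol.feasible hX hN hf hg hk hh₀ hh₀_nonneg hh₀_int hp hp_nonneg hs hst hkM hρ hρ0 hocc
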